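/- Let $m,n,d$ be nonnegative integers such that $m=1$, or $d=1$, or $d=m=2$. Let $N_k$ be the number of monomials of degree $k$ in $x=(x_0,\dots,x_m)$, let $\zeta_k(x)\in\mathbb R^{N_k}$ be the vector of these monomials, indexed by the exponents $\alpha\in\mathbb N^{m+1}$ with $|\alpha|=k$ (the first one being that of $x_0^k$), and for $y=(y_\gamma)_{|\gamma|=2d}\in\mathbb R^{N_{2d}}$ let $M_d(y)=(y_{\alpha+\beta})_{|\alpha|=|\beta|=d}$ be its moment matrix. The oriented projective space of $\mathbb R^{k+1}$ is the set of nonzero vectors modulo multiplication by positive scalars, and $\mathbb P^k_+$ is its subset of points with nonnegative first coordinate. A set of points of it is convex if, whenever nonzero vectors $u,v$ represent two of its points, every nonzero vector of the segment $[u,v]$ represents a point of the set; $\mathrm{conv}\,S$ is the smallest convex set containing $S$. Let $A\in\mathbb R^{(n+1)\times N_{2d}}$ be any matrix, and let $$\mathcal V=\{A\zeta_{2d}(x) : x\in\mathbb P^m,\ A\zeta_{2d}(x)\neq 0\}$$ be the rational variety it defines, regarded as a set of points of the oriented projective space of $\mathbb R^{n+1}$ (this is well defined, because $\zeta_{2d}$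 has even degree). Then $$\mathrm{conv}\,\mathcal V=\{Ay : y\in\mathbb P^{N_{2d}-1}_+,\ M_d(y)\succeq 0,\ Ay\neq 0\}.$$ In particular, if $\mathcal V\subseteq\mathbb P^n_+$ (the form $(A\zeta_{2d}(x))_0$ is nonnegative), then $$\mathrm{conv}\,\mathcal V=\{Ay\in\mathbb P^n_+ : y\in\mathbb P^{N_{2d}-1}_+,\ M_d(y)\succeq 0\}.$$ Consequently $\mathrm{conv}\,\mathcal V$ is semidefinite representable: it is the set of points represented by the nonzero vectors in a linear image of a linear section of a cone of positive semidefinite matrices. -/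

import Mathlib

namespace MomentHull

/-! ### Oriented projective space

The oriented projective space of a real vector space `E` is `Module.Ray ℝ E`: nonzero vectors up to
multiplication by positive scalars. -/

/-- The points of the oriented projective space whose coordinate number `i₀` is nonnegative. -/
def nonnegPart {ι : Type*} (i₀ : ι) : Set (Module.Ray ℝ (ι → ℝ)) :=
  {r | ∃ (v : ι → ℝ) (hv : v ≠ 0), r = rayOfNeZero ℝ v hv ∧ 0 ≤ v i₀}

/-- A set of points of the oriented projective space is convex if, for any two of its points, it
contains the segment that joins them. The segment is swept out by the segments `[u, v]` between
the nonzero vectors `u`, `v` that represent the two points; the zero vector, which occurs on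
`[u, v]` only if the two points are antipodal, does not represent a point. -/
def IsConvex {E : Type*} [AddCommGroup E] [Module ℝ E] (S : Set (Module.Ray ℝ E)) : Prop :=
  ∀ (u v w : E) (hu : u ≠ 0) (hv : v ≠ 0) (hw : w ≠ 0),
    rayOfNeZero ℝ u hu ∈ S → rayOfNeZero ℝ v hv ∈ S → w ∈ segment ℝ u v →
      rayOfNeZero ℝ w hw ∈ S

/-- The convex hull in the oriented projective space: the smallest convex set containing `S`. -/
def conv {E : Type*} [AddCommGroup E] [Module ℝ E] (S : Set (Module.Ray ℝ E)) :
    Set (Module.Ray ℝ E) :=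
  ⋂₀ {T | S ⊆ T ∧ IsConvex T}

/-! ### Monomials and moment matrices -/

/-- Exponents of the monomials of degree `k` in the variables `x₀, …, x_m`. (Forgetting the
exponent of `x₀` gives the `α ∈ ℕ^m` with `|α| ≤ k`.) -/
abbrev Expo (m k : ℕ) : Type := {α : Fin (m + 1) → ℕ // ∑ i, α i = k}

instance instFintypeExpo (m k : ℕ) : Fintype (Expo m k) :=
  Fintype.subtype (Finset.Nat.antidiagonalTuple (m + 1) k)
    (fun _ => Finset.Nat.mem_antidiagonalTuple)

/-- The exponent of the first monomial `x₀ ^ k`. -/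
def Expo.first (m k : ℕ) : Expo m k :=
  ⟨Pi.single 0 k, by simp⟩

/-- The sum of two exponents of degree `d`, an exponent of degree `2 * d`. -/
def Expo.add {m d : ℕ} (α β : Expo m d) : Expo m (2 * d) :=
  ⟨α.1 + β.1, by simp only [Pi.add_apply, Finset.sum_add_distrib, α.2, β.2]; ring⟩

/-- The vector `ζ_k(x)` of all monomials of degree `k` in `x = (x₀, …, x_m)`. -/
def zeta {m : ℕ} (k : ℕ) (x : Fin (m + 1) → ℝ) : Expo m k → ℝ :=
  fun α => ∏ i, x i ^ α.1 i

/-- The moment matrix `M_d(y)`, with entries `y_{α + β}`. -/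
def momentMatrix {m d : ℕ} (y : Expo m (2 * d) → ℝ) : Matrix (Expo m d) (Expo m d) ℝ :=
  Matrix.of fun α β => y (Expo.add α β)

/-! ### Rational varieties -/

/-- The rational variety `{A ζ_{2d}(x) : x ∈ ℙ^m}`. Since `2 * d` is even, the point represented by
`A ζ_{2d}(x)` in the oriented projective space depends only on the point of `ℙ^m` that the
nonzero vector `x` represents. The `x` with `A ζ_{2d}(x) = 0` contribute no point. -/
def variety {m n d : ℕ} (A : Matrix (Fin (n + 1)) (Expo m (2 * d)) ℝ) :
    Set (Module.Ray ℝ (Fin (n + 1) → ℝ)) :=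
  {r | ∃ x : Fin (m + 1) → ℝ, x ≠ 0 ∧
    ∃ h : A.mulVec (zeta (2 * d) x) ≠ 0, r = rayOfNeZero ℝ (A.mulVec (zeta (2 * d) x)) h}

/-- The set of the points `A y`, where `y` is a point of the oriented projective space with
nonnegative first coordinate and with `M_d(y) ⪰ 0`. -/
def momentImage {m n d : ℕ} (A : Matrix (Fin (n + 1)) (Expo m (2 * d)) ℝ) :
    Set (Module.Ray ℝ (Fin (n + 1) → ℝ)) :=
  {r | ∃ (y : Expo m (2 * d) → ℝ) (hy : y ≠ 0),
    rayOfNeZero ℝ y hy ∈ nonnegPart (Expo.first m (2 * d)) ∧ (momentMatrix y).PosSemidef ∧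
      ∃ h : A.mulVec y ≠ 0, r = rayOfNeZero ℝ (A.mulVec y) h}

/-- A set of points of the oriented projective space is semidefinite representable if it is the
projection (linear image) of a linear section of the cone of positive semidefinite matrices. -/
def IsSemidefiniteRepresentable {E : Type*} [AddCommGroup E] [Module ℝ E]
    (S : Set (Module.Ray ℝ E)) : Prop :=
  ∃ (N : ℕ) (L : Submodule ℝ (Matrix (Fin N) (Fin N) ℝ))
    (π : Matrix (Fin N) (Fin N) ℝ →ₗ[ℝ] E),
    S = {r | ∃ X ∈ L, X.PosSemidef ∧ ∃ h : π X ≠ 0, r = rayOfNeZero ℝ (π X) h}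

end MomentHull

/-!
The set `momentImage A` consists of the rays of the nonzero vectors `A y` with `M_d(y) ⪰ 0`. It is
convex and contains the variety, so everything rests on the reverse inclusion: a vector `y` with
`M_d(y) ⪰ 0` is a nonnegative multiple of a convex combination of vectors `ζ_{2d}(x)` with `x` on the
unit sphere (`DominatesSquare.exists_eq_smul_mem_convexHull`). The convex hull of the compact set of
these vectors is compact, so otherwise a hyperplane separates them from a multiple of `y`. It gives a
nonnegative form `F` of degree `2d` whose pairing with `y` is negative.

Such an `F` does not exist if nonnegative forms are sums of squares. It is enough that every nonzero
nonnegative form dominates the square of a nonzero form (`DominatesSquare`). Namely, minimize the ratio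
of the pairing with `y` to a strictly positive functional over the nonnegative forms. If the minimum
is negative, then subtracting a dominated square `q²` from a minimizer makes the ratio smaller, since
the pairing of `q²` with `y` is nonnegative (`DominatesSquare.dotProduct_nonneg`).

A form that is positive away from the origin dominates a multiple of any form of the same degree, so
only forms with a nontrivial zero need care.
* For quadratic forms, the square is given by the Cauchy-Schwarz inequality (`dominatesSquare_one`).
* For binary forms, a zero gives a factor that is the square of a linear form
  (`dominatesSquare_two`).
* For ternary quartics (Hilbert's theorem), the argument is that of Choi and Lam. Move the zero to
  `(1, 0, 0)`, so that `F = x² A + 2 x G + H` with binary forms `A`, `G`, `H`. Either `A` is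
  degenerate, or `F` dominates a multiple of `A²`, or `F` has a second zero. In the last case move
  that zero to `(0, 1, 0)`, so that `F = x² A + 2 x z B + z² C` is controlled by the binary quadratic
  forms `A`, `B`, `C` (`dominatesSquare_three_two`).
-/

open Matrix

namespace MomentHull

/-! ### Forms and their coefficient vectors -/

/-- A form (homogeneous polynomial function) of degree `k` in `n` real variables. -/
def IsForm {n : ℕ} (k : ℕ) (f : (Fin n → ℝ) → ℝ) : Prop :=
  ∃ P : MvPolynomial (Fin n) ℝ, P.IsHomogeneous k ∧ ∀ x, f x = MvPolynomial.eval x P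

namespace IsForm

variable {n k l : ℕ} {f g : (Fin n → ℝ) → ℝ}

theorem add (hf : IsForm k f) (hg : IsForm k g) : IsForm k (fun x => f x + g x) := by
  obtain ⟨P, hP, hf⟩ := hf
  obtain ⟨Q, hQ, hg⟩ := hg
  exact ⟨P + Q, hP.add hQ, fun x => by simp [hf, hg]⟩

theorem sub (hf : IsForm k f) (hg : IsForm k g) : IsForm k (fun x => f x - g x) := by
  obtain ⟨P, hP, hf⟩ := hf
  obtain ⟨Q, hQ, hg⟩ := hg
  exact ⟨P - Q, hP.sub hQ, fun x => by simp [hf, hg]⟩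

theorem mul (hf : IsForm k f) (hg : IsForm l g) : IsForm (k + l) (fun x => f x * g x) := by
  obtain ⟨P, hP, hf⟩ := hf
  obtain ⟨Q, hQ, hg⟩ := hg
  exact ⟨P * Q, hP.mul hQ, fun x => by simp [hf, hg]⟩

theorem const_mul (c : ℝ) (hf : IsForm k f) : IsForm k (fun x => c * f x) := by
  obtain ⟨P, hP, hf⟩ := hf
  exact ⟨MvPolynomial.C c * P, hP.C_mul c, fun x => by simp [hf]⟩

theorem pow (hf : IsForm k f) (j : ℕ) : IsForm (k * j) (fun x => f x ^ j) := by
  obtain ⟨P, hP, hf⟩ := hf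
  exact ⟨P ^ j, hP.pow j, fun x => by simp [hf]⟩

theorem coord (i : Fin n) : IsForm 1 (fun x : Fin n → ℝ => x i) :=
  ⟨MvPolynomial.X i, MvPolynomial.isHomogeneous_X ℝ i, fun x => by simp⟩

theorem zero (k : ℕ) : IsForm k (fun _ : Fin n → ℝ => 0) :=
  ⟨0, MvPolynomial.isHomogeneous_zero _ _ _, fun x => by simp⟩

theorem sum {ι : Type*} (s : Finset ι) {F : ι → (Fin n → ℝ) → ℝ} (h : ∀ i ∈ s, IsForm k (F i)) :
    IsForm k (fun x => ∑ i ∈ s, F i x) := by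
  classical
  induction s using Finset.induction_on with
  | empty => simpa using zero k
  | insert a s ha ih =>
    simp only [Finset.sum_insert ha]
    exact (h a (Finset.mem_insert_self a s)).add
      (ih fun i hi => h i (Finset.mem_insert_of_mem hi))

theorem continuous (hf : IsForm k f) : Continuous f := by
  obtain ⟨P, -, hf⟩ := hf
  rw [funext hf]
  exact MvPolynomial.continuous_eval P

theorem linear (a : Fin n → ℝ) : IsForm 1 (fun x : Fin n → ℝ => a ⬝ᵥ x) :=
  IsForm.sum Finset.univ (F := fun i x => a i * x i) fun i _ => (coord i).const_mul (a i)

/-- Forms are stable under linear substitution. -/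
theorem comp_linear {r : ℕ} (hf : IsForm k f) (T : (Fin r → ℝ) →ₗ[ℝ] (Fin n → ℝ)) :
    IsForm k (fun x => f (T x)) := by
  obtain ⟨P, hP, hf⟩ := hf
  have h1 : ∀ i, IsForm 1 (fun x => T x i) := fun i => by
    have := linear (fun j => T (Pi.single j 1) i)
    refine (congrArg (IsForm 1) (funext fun x => ?_)).mp this
    rw [T.pi_apply_eq_sum_univ x]
    simp only [dotProduct, Finset.sum_apply, Pi.smul_apply, smul_eq_mul]
    refine Finset.sum_congr rfl fun j _ => ?_
    rw [mul_comm]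
    refine congrArg (x j * ·) (congrFun (congrArg T (funext fun t => ?_)) i)
    simp [Pi.single_apply, eq_comm]
  choose Q hQ hQe using h1
  refine ⟨MvPolynomial.aeval Q P, ?_, fun x => ?_⟩
  · simpa using hP.aeval Q hQ
  · simp only [hf]
    rw [MvPolynomial.aeval_def, MvPolynomial.eval_eval₂]
    have : (MvPolynomial.eval x).comp (algebraMap ℝ (MvPolynomial (Fin r) ℝ)) = RingHom.id ℝ := by
      ext; simp
    rw [this, MvPolynomial.eval₂_id]
    congr 2
    funext i
    exact hQe i x

theorem map_smul (hf : IsForm k f) (t : ℝ) (x : Fin n → ℝ) : f (t • x) = t ^ k * f x := by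
  obtain ⟨P, hP, hf⟩ := hf
  rw [hf, hf, MvPolynomial.eval_eq', MvPolynomial.eval_eq', Finset.mul_sum]
  refine Finset.sum_congr rfl fun s hs => ?_
  have hk := hP.degree_eq_sum_deg_support hs
  have : ∑ i, s i = k := by
    rw [hk]
    exact (Finsupp.degree_eq_sum s).symm
  simp only [Pi.smul_apply, smul_eq_mul, mul_pow, Finset.prod_mul_distrib,
    Finset.prod_pow_eq_pow_sum, this]
  ring

end IsForm

theorem Expo.sum_symm_eq_degree {m k : ℕ} (α : Expo m k) :
    (Finsupp.equivFunOnFinite.symm α.1).degree = k := by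
  rw [Finsupp.degree_eq_sum]
  exact α.2

theorem isForm_dotProduct_zeta {m k : ℕ} (p : Expo m k → ℝ) :
    IsForm k (fun x => p ⬝ᵥ zeta k x) := by
  refine IsForm.sum Finset.univ (F := fun α x => p α * zeta k x α) fun α _ => ?_
  refine ⟨MvPolynomial.monomial (Finsupp.equivFunOnFinite.symm α.1) (p α),
    MvPolynomial.isHomogeneous_monomial _ (Expo.sum_symm_eq_degree α), fun x => ?_⟩
  rw [MvPolynomial.eval_monomial, Finsupp.prod_fintype _ _ (by simp)]
  simp [zeta]

/-- Every form is given by a coefficient vector. -/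
theorem IsForm.exists_coeff {m k : ℕ} {f : (Fin (m + 1) → ℝ) → ℝ} (hf : IsForm k f) :
    ∃ p : Expo m k → ℝ, ∀ x, f x = p ⬝ᵥ zeta k x := by
  classical
  obtain ⟨P, hP, hf⟩ := hf
  refine ⟨fun α => P.coeff (Finsupp.equivFunOnFinite.symm α.1), fun x => ?_⟩
  rw [hf, MvPolynomial.eval_eq']
  have hinj : Function.Injective fun α : Expo m k => Finsupp.equivFunOnFinite.symm α.1 :=
    fun α β h => Subtype.ext (Finsupp.equivFunOnFinite.symm.injective h)
  have hsub : P.support ⊆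
      Finset.univ.image fun α : Expo m k => Finsupp.equivFunOnFinite.symm α.1 := by
    intro s hs
    have hk := hP.degree_eq_sum_deg_support hs
    have hs' : ∑ i, s i = k := (Finsupp.degree_eq_sum s).symm.trans hk.symm
    exact Finset.mem_image.2 ⟨⟨s, hs'⟩, Finset.mem_univ _, by ext; simp⟩
  rw [Finset.sum_subset hsub fun s _ hs => by rw [MvPolynomial.notMem_support_iff.1 hs, zero_mul],
    Finset.sum_image hinj.injOn]
  rfl

/-- The monomials of degree `k` are linearly independent as functions. -/
theorem coeff_eq_zero_of_forall_dotProduct_zeta {m k : ℕ} {p : Expo m k → ℝ}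
    (h : ∀ x, p ⬝ᵥ zeta k x = 0) : p = 0 := by
  classical
  set P : MvPolynomial (Fin (m + 1)) ℝ :=
    ∑ α : Expo m k, MvPolynomial.monomial (Finsupp.equivFunOnFinite.symm α.1) (p α) with hPdef
  have hP : P = 0 := by
    refine MvPolynomial.funext fun x => ?_
    rw [map_zero, ← h x, hPdef, map_sum]
    refine Finset.sum_congr rfl fun α _ => ?_
    rw [MvPolynomial.eval_monomial, Finsupp.prod_fintype _ _ (by simp)]
    simp [zeta]
  funext β
  have hβ : P.coeff (Finsupp.equivFunOnFinite.symm β.1) = 0 := by rw [hP]; simp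
  rw [hPdef, MvPolynomial.coeff_sum, Finset.sum_eq_single β] at hβ
  · simpa using hβ
  · intro α _ hα
    rw [MvPolynomial.coeff_monomial, if_neg]
    exact fun h => hα (Subtype.ext (Finsupp.equivFunOnFinite.symm.injective h))
  · simp

/-- A form that is positive away from the origin dominates a positive multiple of any other form
of the same degree: compare the two on the unit sphere. -/
theorem IsForm.exists_pos_mul_le {n k : ℕ} {f g : (Fin n → ℝ) → ℝ} (hf : IsForm k f)
    (hg : IsForm k g) (hpos : ∀ x, x ≠ 0 → 0 < f x) (h0 : g 0 ≤ 0 ∧ 0 ≤ f 0) :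
    ∃ δ > 0, ∀ x, δ * g x ≤ f x := by
  have hS : IsCompact (Metric.sphere (0 : Fin n → ℝ) 1) := isCompact_sphere 0 1
  have key : ∃ δ > 0, ∀ x ∈ Metric.sphere (0 : Fin n → ℝ) 1, δ * g x ≤ f x := by
    rcases (Metric.sphere (0 : Fin n → ℝ) 1).eq_empty_or_nonempty with he | hne
    · exact ⟨1, one_pos, by simp [he]⟩
    obtain ⟨a, ha, hmin⟩ := hS.exists_isMinOn hne hf.continuous.continuousOn
    obtain ⟨b, -, hmax⟩ := hS.exists_isMaxOn hne hg.continuous.abs.continuousOn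
    have hfa : 0 < f a := hpos a fun h => by simp [h] at ha
    refine ⟨f a / (|g b| + 1), by positivity, fun x hx => ?_⟩
    have h1 : f a ≤ f x := hmin hx
    have h2 : |g x| ≤ |g b| := hmax hx
    refine le_trans ?_ h1
    rw [div_mul_eq_mul_div, div_le_iff₀ (by positivity)]
    have := le_abs_self (g x)
    exact mul_le_mul_of_nonneg_left (by linarith) hfa.le
  obtain ⟨δ, hδ, H⟩ := key
  refine ⟨δ, hδ, fun x => ?_⟩
  rcases eq_or_ne x 0 with rfl | hx
  · nlinarith [h0.1, h0.2, mul_nonneg hδ.le (neg_nonneg.2 h0.1)]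
  have hn : 0 < ‖x‖ := norm_pos_iff.2 hx
  have hx' : x = ‖x‖ • (‖x‖⁻¹ • x) := by rw [smul_smul, mul_inv_cancel₀ hn.ne', one_smul]
  rw [hx', hf.map_smul, hg.map_smul]
  have := H (‖x‖⁻¹ • x) (by simp [norm_smul, hn.ne'])
  have := mul_le_mul_of_nonneg_left this (pow_nonneg hn.le k)
  linarith

/-- Every nonzero nonnegative form of degree `2 * d` in `n` variables dominates the square of a
nonzero form of degree `d`. -/
def DominatesSquare (n d : ℕ) : Prop :=
  ∀ f : (Fin n → ℝ) → ℝ, IsForm (2 * d) f → (∀ x, 0 ≤ f x) → (∃ x, f x ≠ 0) →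
    ∃ q : (Fin n → ℝ) → ℝ, IsForm d q ∧ (∃ x, q x ≠ 0) ∧ ∀ x, q x ^ 2 ≤ f x

/-- A form that is positive away from the origin dominates the square of a multiple of `x₀ ^ d`. -/
theorem exists_sq_le_of_pos {m d : ℕ} {f : (Fin (m + 1) → ℝ) → ℝ} (hf : IsForm (2 * d) f)
    (h0 : ∀ x, 0 ≤ f x) (hne : ∃ x, f x ≠ 0) (hpos : ∀ x, x ≠ 0 → 0 < f x) :
    ∃ q : (Fin (m + 1) → ℝ) → ℝ, IsForm d q ∧ (∃ x, q x ≠ 0) ∧ ∀ x, q x ^ 2 ≤ f x := by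
  have hX : IsForm d (fun x : Fin (m + 1) → ℝ => x 0 ^ d) := by
    simpa using (IsForm.coord (0 : Fin (m + 1))).pow d
  have hX2 : IsForm (2 * d) (fun x : Fin (m + 1) → ℝ => (x 0 ^ d) ^ 2) := by
    simpa [mul_comm] using hX.pow 2
  have key : ∃ δ > 0, ∀ x, δ * (x 0 ^ d) ^ 2 ≤ f x := by
    rcases Nat.eq_zero_or_pos d with rfl | hd
    · obtain ⟨y, hy⟩ := hne
      refine ⟨f y, (h0 y).lt_of_ne' hy, fun x => ?_⟩
      have h1 := hf.map_smul 0 x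
      have h2 := hf.map_smul 0 y
      simp at h1 h2
      simp [← h1, ← h2]
    · exact hf.exists_pos_mul_le hX2 hpos ⟨by simp [hd.ne'], h0 0⟩
  obtain ⟨δ, hδ, H⟩ := key
  refine ⟨fun x => √δ * x 0 ^ d, hX.const_mul _, ⟨fun _ => 1, ?_⟩, fun x => ?_⟩
  · simp [(Real.sqrt_pos.2 hδ).ne']
  · rw [mul_pow, Real.sq_sqrt hδ.le]
    exact H x

/-! ### Binary forms and quadratic forms -/

/-- The linear form on `ℝ²` whose zero set is the line through `a` (if `a ≠ 0`). -/
def cross (a v : Fin 2 → ℝ) : ℝ := a 1 * v 0 - a 0 * v 1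

theorem isForm_cross (a : Fin 2 → ℝ) : IsForm 1 (cross a) :=
  ((IsForm.coord 0).const_mul (a 1)).sub ((IsForm.coord 1).const_mul (a 0))

theorem sq_add_sq_pos_of_ne_zero {a : Fin 2 → ℝ} (ha : a ≠ 0) : 0 < a 0 ^ 2 + a 1 ^ 2 := by
  by_contra h
  have h0 : a 0 = 0 := by nlinarith [sq_nonneg (a 0), sq_nonneg (a 1)]
  have h1 : a 1 = 0 := by nlinarith [sq_nonneg (a 0), sq_nonneg (a 1)]
  exact ha (by ext i; fin_cases i <;> simp [h0, h1])

theorem exists_cross_ne_zero {a : Fin 2 → ℝ} (ha : a ≠ 0) : ∃ v, cross a v ≠ 0 :=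
  ⟨![a 1, -a 0], by simpa [cross, sq, add_comm] using (sq_add_sq_pos_of_ne_zero ha).ne'⟩

theorem nonneg_of_forall_pos_nonneg {φ : ℝ → ℝ} (hφ : Continuous φ) (h : ∀ t > 0, 0 ≤ φ t) :
    0 ≤ φ 0 :=
  ge_of_tendsto (hφ.continuousWithinAt (s := Set.Ioi 0) (x := 0))
    (Filter.eventually_of_mem self_mem_nhdsWithin h)

theorem cross_add_smul (a v : Fin 2 → ℝ) (t : ℝ) :
    cross a (v + t • ![a 1, -a 0]) = cross a v + t * (a 0 ^ 2 + a 1 ^ 2) := by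
  simp [cross]
  ring

/-- A continuous function that is nonnegative off a line is nonnegative everywhere. -/
theorem nonneg_of_cross_sq_mul_nonneg {g : (Fin 2 → ℝ) → ℝ} (hg : Continuous g) {a : Fin 2 → ℝ}
    (ha : a ≠ 0) (h : ∀ v, 0 ≤ cross a v ^ 2 * g v) (v : Fin 2 → ℝ) : 0 ≤ g v := by
  have hN := sq_add_sq_pos_of_ne_zero ha
  by_cases hv : cross a v = 0
  · have := nonneg_of_forall_pos_nonneg (φ := fun t => g (v + t • ![a 1, -a 0])) (by fun_prop)
      fun t ht => by
        have h1 := h (v + t • ![a 1, -a 0])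
        rw [cross_add_smul, hv, zero_add] at h1
        exact nonneg_of_mul_nonneg_right h1 (by positivity)
    simpa using this
  · exact nonneg_of_mul_nonneg_right (h v) (by positivity)

/-- If `cross a * g` does not change sign along the line through `a`, then `g` vanishes at `a`. -/
theorem eq_zero_of_cross_mul_nonneg {g : (Fin 2 → ℝ) → ℝ} (hg : Continuous g) {a : Fin 2 → ℝ}
    (ha : a ≠ 0) (h : ∀ v, 0 ≤ cross a v * g v) : g a = 0 := by
  have hN := sq_add_sq_pos_of_ne_zero ha
  have haa : cross a a = 0 := by simp [cross]; ring
  have hline : ∀ t, 0 ≤ t * (a 0 ^ 2 + a 1 ^ 2) * g (a + t • ![a 1, -a 0]) := fun t => by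
    have h1 := h (a + t • ![a 1, -a 0])
    rwa [cross_add_smul, haa, zero_add] at h1
  have h1 := nonneg_of_forall_pos_nonneg (φ := fun t => g (a + t • ![a 1, -a 0])) (by fun_prop)
    fun t ht => nonneg_of_mul_nonneg_right (hline t) (by positivity)
  have h2 := nonneg_of_forall_pos_nonneg (φ := fun t => -g (a + (-t) • ![a 1, -a 0]))
    (by fun_prop) fun t ht => by
      refine nonneg_of_mul_nonneg_right (a := t * (a 0 ^ 2 + a 1 ^ 2)) ?_ (by positivity)
      have := hline (-t)
      linarith
  simp at h1 h2
  linarith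

theorem IsForm.exists_binary_split {k : ℕ} {f : (Fin 2 → ℝ) → ℝ} (hf : IsForm (k + 1) f) :
    ∃ (g : (Fin 2 → ℝ) → ℝ) (c : ℝ), IsForm k g ∧ ∀ v, f v = v 0 * g v + c * v 1 ^ (k + 1) := by
  classical
  obtain ⟨p, hp⟩ := hf.exists_coeff
  have key : ∀ s : Finset (Expo 1 (k + 1)), ∃ (g : (Fin 2 → ℝ) → ℝ) (c : ℝ), IsForm k g ∧
      ∀ v, ∑ α ∈ s, p α * zeta (k + 1) v α = v 0 * g v + c * v 1 ^ (k + 1) := by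
    intro s
    induction s using Finset.induction_on with
    | empty => exact ⟨fun _ => 0, 0, IsForm.zero k, fun v => by simp⟩
    | insert α s hα ih =>
      obtain ⟨g, c, hg, h⟩ := ih
      obtain ⟨e, he⟩ := α
      rw [Fin.sum_univ_two] at he
      rcases h0 : e 0 with _ | j
      · refine ⟨g, c + p ⟨e, by rwa [Fin.sum_univ_two]⟩, hg, fun v => ?_⟩
        rw [Finset.sum_insert hα, h]
        have h1 : e 1 = k + 1 := by omega
        simp [zeta, h0, h1]
        ring
      · have h1 : j + e 1 = k := by omega
        have hmon : IsForm k fun v : Fin 2 → ℝ => v 0 ^ j * v 1 ^ e 1 := by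
          have := ((IsForm.coord (0 : Fin 2)).pow j).mul ((IsForm.coord (1 : Fin 2)).pow (e 1))
          rwa [one_mul, one_mul, h1] at this
        refine ⟨_, c, hg.add (hmon.const_mul (p ⟨e, by rwa [Fin.sum_univ_two]⟩)), fun v => ?_⟩
        rw [Finset.sum_insert hα, h]
        simp [zeta, h0]
        ring
  obtain ⟨g, c, hg, h⟩ := key Finset.univ
  exact ⟨g, c, hg, fun v => (hp v).trans (h v)⟩

/-- A binary form that vanishes at `a ≠ 0` is divisible by the linear form `cross a`. -/
theorem IsForm.exists_eq_cross_mul {k : ℕ} {f : (Fin 2 → ℝ) → ℝ} (hf : IsForm (k + 1) f)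
    {a : Fin 2 → ℝ} (ha : a ≠ 0) (hfa : f a = 0) :
    ∃ g : (Fin 2 → ℝ) → ℝ, IsForm k g ∧ ∀ v, f v = cross a v * g v := by
  have hN := sq_add_sq_pos_of_ne_zero ha
  set N := a 0 ^ 2 + a 1 ^ 2 with hNdef
  -- `T` is the similarity that maps the second basis vector to `a`, and `S` is its inverse.
  let T : (Fin 2 → ℝ) →ₗ[ℝ] (Fin 2 → ℝ) := Matrix.mulVecLin !![a 1, a 0; -a 0, a 1]
  let S : (Fin 2 → ℝ) →ₗ[ℝ] (Fin 2 → ℝ) :=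
    Matrix.mulVecLin !![a 1 / N, -a 0 / N; a 0 / N, a 1 / N]
  have hTS : ∀ v, T (S v) = v := fun v => by
    ext i
    fin_cases i <;> simp [T, S, Matrix.mulVec, dotProduct, Fin.sum_univ_two] <;> field_simp <;>
      rw [hNdef] <;> ring
  obtain ⟨g, c, hg, h⟩ := (hf.comp_linear T).exists_binary_split
  have hT1 : T ![0, 1] = a := by
    ext i
    fin_cases i <;> simp [T, Matrix.mulVec, dotProduct, Fin.sum_univ_two]
  have hc : c = 0 := by
    have := h ![0, 1]
    rw [hT1, hfa] at this
    simpa using this.symm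
  refine ⟨_, (hg.comp_linear S).const_mul N⁻¹, fun v => ?_⟩
  have := h (S v)
  rw [hTS, hc] at this
  rw [this]
  simp [S, Matrix.mulVec, dotProduct, Fin.sum_univ_two, cross]
  field_simp
  ring

/-- A nonnegative binary form that is not positive has a linear factor, which occurs twice; so
induction on the degree applies. -/
theorem dominatesSquare_two (d : ℕ) : DominatesSquare 2 d := by
  induction d with
  | zero =>
    intro f hf h0 hne
    refine exists_sq_le_of_pos hf h0 hne fun x _ => ?_
    obtain ⟨y, hy⟩ := hne
    have h1 := hf.map_smul 0 x
    have h2 := hf.map_smul 0 y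
    simp at h1 h2
    rw [← h1, h2]
    exact (h0 y).lt_of_ne' hy
  | succ d ih =>
    intro f hf h0 hne
    by_cases hpos : ∀ x, x ≠ 0 → 0 < f x
    · exact exists_sq_le_of_pos hf h0 hne hpos
    push Not at hpos
    obtain ⟨a, ha, hfa⟩ := hpos
    obtain ⟨g, hg, hfg⟩ := IsForm.exists_eq_cross_mul (k := 2 * d + 1) hf ha
      (le_antisymm hfa (h0 a))
    have hga := eq_zero_of_cross_mul_nonneg hg.continuous ha fun v => hfg v ▸ h0 v
    obtain ⟨e, he, hge⟩ := hg.exists_eq_cross_mul ha hga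
    have hfe : ∀ v, f v = cross a v ^ 2 * e v := fun v => by rw [hfg, hge]; ring
    have he0 := nonneg_of_cross_sq_mul_nonneg he.continuous ha fun v => hfe v ▸ h0 v
    obtain ⟨x, hx⟩ := hne
    obtain ⟨q, hq, ⟨y, hy⟩, hqe⟩ := ih e he he0 ⟨x, fun h => hx (by rw [hfe, h, mul_zero])⟩
    refine ⟨fun v => q v * cross a v, hq.mul (isForm_cross a), ?_, fun v => ?_⟩
    · by_contra hall
      push Not at hall
      have := nonneg_of_cross_sq_mul_nonneg (g := fun v => -q v ^ 2)
        (by have := hq.continuous; fun_prop) ha (fun v => by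
          have := hall v
          nlinarith [this]) y
      have := sq_nonneg (q y)
      exact hy (by nlinarith)
    · rw [hfe, mul_pow, mul_comm]
      exact mul_le_mul_of_nonneg_left (hqe v) (sq_nonneg _)

theorem Expo.exists_add {m d : ℕ} (γ : Expo m (2 * d)) : ∃ α β : Expo m d, Expo.add α β = γ := by
  have key : ∀ j ≤ 2 * d, ∃ α : Fin (m + 1) → ℕ, α ≤ γ.1 ∧ ∑ i, α i = j := by
    intro j
    induction j with
    | zero => exact fun _ => ⟨0, fun i => Nat.zero_le _, by simp⟩
    | succ j ih =>
      intro hj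
      obtain ⟨α, hα, hs⟩ := ih (by omega)
      obtain ⟨i, -, hi⟩ := Finset.exists_lt_of_sum_lt (s := Finset.univ) (f := α) (g := γ.1)
        (by rw [hs, γ.2]; omega)
      refine ⟨α + Pi.single i 1, fun t => ?_, by simp [Finset.sum_add_distrib, hs]⟩
      rcases eq_or_ne t i with rfl | ht
      · simpa using hi
      · simpa [ht] using hα t
  obtain ⟨α, hα, hs⟩ := key d (by omega)
  have hsum : ∑ i, (γ.1 - α) i = d := by
    have : ∑ i, (γ.1 - α) i + ∑ i, α i = ∑ i, γ.1 i := by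
      rw [← Finset.sum_add_distrib]
      exact Finset.sum_congr rfl fun i _ => Nat.sub_add_cancel (hα i)
    rw [hs, γ.2] at this
    omega
  exact ⟨⟨α, hs⟩, ⟨γ.1 - α, hsum⟩, Subtype.ext (add_tsub_cancel_of_le hα)⟩

theorem zeta_add {m d : ℕ} (x : Fin (m + 1) → ℝ) (α β : Expo m d) :
    zeta (2 * d) x (Expo.add α β) = zeta d x α * zeta d x β := by
  simp [zeta, Expo.add, pow_add, Finset.prod_mul_distrib]

theorem Expo.exists_zeta_one_eq {m : ℕ} (α : Expo m 1) :
    ∃ i, ∀ x : Fin (m + 1) → ℝ, zeta 1 x α = x i := by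
  obtain ⟨i, hi⟩ : ∃ i, α.1 i ≠ 0 := by
    by_contra! h
    simpa [h] using α.2
  have hs := α.2
  rw [← Finset.add_sum_erase _ _ (Finset.mem_univ i)] at hs
  have h1 : α.1 i = 1 := by omega
  have h2 : ∑ j ∈ Finset.univ.erase i, α.1 j = 0 := by omega
  refine ⟨i, fun x => ?_⟩
  rw [zeta, ← Finset.mul_prod_erase _ _ (Finset.mem_univ i), h1, pow_one,
    Finset.prod_eq_one fun j hj => ?_, mul_one]
  rw [Finset.sum_eq_zero_iff.1 h2 j hj, pow_zero]

theorem sq_le_mul_of_forall_quadratic_nonneg {a b c : ℝ}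
    (h : ∀ x : ℝ, 0 ≤ x ^ 2 * a + 2 * x * b + c) : 0 ≤ a ∧ 0 ≤ c ∧ b ^ 2 ≤ a * c := by
  have hd : discrim a (2 * b) c ≤ 0 := discrim_le_zero fun x => by
    have := h x
    linarith
  have hb : b ^ 2 ≤ a * c := by
    rw [discrim] at hd
    linarith
  have hc : 0 ≤ c := by simpa using h 0
  refine ⟨?_, hc, hb⟩
  by_contra ha
  push Not at ha
  have hb0 : b = 0 := by
    have := mul_nonneg hc (neg_pos.2 ha).le
    exact pow_eq_zero_iff (two_ne_zero) |>.1 (by nlinarith [sq_nonneg b])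
  have hc0 : c = 0 := by
    rw [hb0] at hb
    by_contra hne
    have := mul_pos (hc.lt_of_ne' hne) (neg_pos.2 ha)
    linarith
  have := h 1
  rw [hb0, hc0] at this
  linarith

/-- If `f w > 0` and `B` is the polar form of `f`, then `B w x ^ 2 ≤ f w * f x` by the
Cauchy-Schwarz inequality. -/
theorem dominatesSquare_one (m : ℕ) : DominatesSquare (m + 1) 1 := by
  intro f hf h0 ⟨w, hw⟩
  have hw : 0 < f w := (h0 w).lt_of_ne' hw
  obtain ⟨p, hp⟩ := hf.exists_coeff
  have hmon : ∀ γ : Expo m (2 * 1), ∃ i j, ∀ x : Fin (m + 1) → ℝ,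
      zeta (2 * 1) x γ = x i * x j := fun γ => by
    obtain ⟨α, β, rfl⟩ := Expo.exists_add γ
    obtain ⟨i, hi⟩ := Expo.exists_zeta_one_eq α
    obtain ⟨j, hj⟩ := Expo.exists_zeta_one_eq β
    exact ⟨i, j, fun x => by rw [zeta_add, hi, hj]⟩
  choose i j hij using hmon
  have hfe : ∀ x, f x = ∑ γ, p γ * (x (i γ) * x (j γ)) := fun x => by
    rw [hp]
    exact Finset.sum_congr rfl fun γ _ => by rw [hij]
  set B : (Fin (m + 1) → ℝ) → ℝ := fun x =>
    ∑ γ, p γ / 2 * (w (i γ) * x (j γ) + w (j γ) * x (i γ)) with hB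
  have hBf : IsForm 1 B := IsForm.sum Finset.univ fun γ _ =>
    (((IsForm.coord (j γ)).const_mul (w (i γ))).add
      ((IsForm.coord (i γ)).const_mul (w (j γ)))).const_mul (p γ / 2)
  have hBw : B w = f w := by
    rw [hfe]
    exact Finset.sum_congr rfl fun γ _ => by ring
  have hexp : ∀ x (t : ℝ), f (x + t • w) = t ^ 2 * f w + 2 * t * B x + f x := fun x t => by
    rw [hfe, hfe w, hfe x, hB, Finset.mul_sum, Finset.mul_sum, ← Finset.sum_add_distrib,
      ← Finset.sum_add_distrib]
    refine Finset.sum_congr rfl fun γ _ => ?_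
    simp only [Pi.add_apply, Pi.smul_apply, smul_eq_mul]
    ring
  refine ⟨fun x => (√(f w))⁻¹ * B x, hBf.const_mul _, ⟨w, ?_⟩, fun x => ?_⟩
  · simp only [hBw]
    positivity
  · have := (sq_le_mul_of_forall_quadratic_nonneg fun t => hexp x t ▸ h0 (x + t • w)).2.2
    rw [mul_pow, inv_pow, Real.sq_sqrt hw.le, inv_mul_le_iff₀ hw]
    exact this

/-! ### Ternary quartics with zeros at coordinate points -/

theorem IsForm.exists_quartic_coeffs {f : (Fin 3 → ℝ) → ℝ} (hf : IsForm 4 f) :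
    ∃ c : Fin 15 → ℝ, ∀ w, f w = c 0 * w 0 ^ 4 + c 1 * (w 0 ^ 3 * w 1) + c 2 * (w 0 ^ 3 * w 2)
      + c 3 * (w 0 ^ 2 * w 1 ^ 2) + c 4 * (w 0 ^ 2 * w 1 * w 2) + c 5 * (w 0 ^ 2 * w 2 ^ 2)
      + c 6 * (w 0 * w 1 ^ 3) + c 7 * (w 0 * w 1 ^ 2 * w 2) + c 8 * (w 0 * w 1 * w 2 ^ 2)
      + c 9 * (w 0 * w 2 ^ 3) + c 10 * w 1 ^ 4 + c 11 * (w 1 ^ 3 * w 2)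
      + c 12 * (w 1 ^ 2 * w 2 ^ 2) + c 13 * (w 1 * w 2 ^ 3) + c 14 * w 2 ^ 4 := by
  obtain ⟨p, hp⟩ := hf.exists_coeff (m := 2)
  let q : (Fin 3 → ℕ) → ℝ := fun a => if h : ∑ i, a i = 4 then p ⟨a, h⟩ else 0
  have hsum : ∀ w, f w = ∑ a ∈ Finset.Nat.antidiagonalTuple 3 4, q a * ∏ i, w i ^ a i := by
    intro w
    rw [hp]
    refine Finset.sum_bij (fun a _ => a.1) (fun a _ => Finset.Nat.mem_antidiagonalTuple.2 a.2)
      (fun a _ b _ h => Subtype.ext h)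
      (fun b hb => ⟨⟨b, Finset.Nat.mem_antidiagonalTuple.1 hb⟩, Finset.mem_univ _, rfl⟩)
      fun a _ => ?_
    have ha : q a.1 = p a := dif_pos a.2
    rw [ha]
    rfl
  have hlist : Finset.Nat.antidiagonalTuple 3 4 = {![0, 0, 4], ![0, 1, 3], ![0, 2, 2], ![0, 3, 1],
      ![0, 4, 0], ![1, 0, 3], ![1, 1, 2], ![1, 2, 1], ![1, 3, 0], ![2, 0, 2], ![2, 1, 1],
      ![2, 2, 0], ![3, 0, 1], ![3, 1, 0], ![4, 0, 0]} := by decide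
  refine ⟨![q ![4, 0, 0], q ![3, 1, 0], q ![3, 0, 1], q ![2, 2, 0], q ![2, 1, 1], q ![2, 0, 2],
    q ![1, 3, 0], q ![1, 2, 1], q ![1, 1, 2], q ![1, 0, 3], q ![0, 4, 0], q ![0, 3, 1],
    q ![0, 2, 2], q ![0, 1, 3], q ![0, 0, 4]], fun w => ?_⟩
  rw [hsum, hlist]
  simp [Fin.prod_univ_three]
  ring

theorem eq_zero_of_forall_cubic_nonneg {a b c e : ℝ}
    (h : ∀ t : ℝ, 0 ≤ a * t ^ 3 + b * t ^ 2 + c * t + e) : a = 0 := by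
  -- Divide by `t ^ 3` and let `1 / t` tend to zero from either side.
  have key : ∀ s : ℝ, s ≠ 0 → 0 ≤ s ^ 4 * (a * s⁻¹ ^ 3 + b * s⁻¹ ^ 2 + c * s⁻¹ + e) :=
    fun s _ => mul_nonneg (by positivity) (h s⁻¹)
  have hs : ∀ s : ℝ, s ≠ 0 → 0 ≤ s * (a + b * s + c * s ^ 2 + e * s ^ 3) := fun s hs => by
    refine (key s hs).trans_eq ?_
    field_simp
  have h1 := nonneg_of_forall_pos_nonneg (φ := fun s => a + b * s + c * s ^ 2 + e * s ^ 3)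
    (by fun_prop) fun s hpos => nonneg_of_mul_nonneg_right (hs s hpos.ne') hpos
  have h2 := nonneg_of_forall_pos_nonneg
    (φ := fun s => -(a + b * (-s) + c * (-s) ^ 2 + e * (-s) ^ 3))
    (by fun_prop) fun s hpos => nonneg_of_mul_nonneg_right (a := s)
      (by have := hs (-s) (neg_ne_zero.2 hpos.ne'); linarith) hpos
  simp at h1 h2
  linarith

/-- The projection `(x, y, z) ↦ (y, z)`. -/
def dropFirst : (Fin 3 → ℝ) →ₗ[ℝ] (Fin 2 → ℝ) := LinearMap.funLeft ℝ ℝ Fin.succ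

@[simp] theorem dropFirst_apply (w : Fin 3 → ℝ) (i : Fin 2) : dropFirst w i = w i.succ := rfl

@[simp] theorem dropFirst_cons (x : ℝ) (v : Fin 2 → ℝ) : dropFirst (vecCons x v) = v := by
  ext i
  simp

theorem isForm_binary_quadratic (a b c : ℝ) :
    IsForm 2 (fun v : Fin 2 → ℝ => a * v 0 ^ 2 + b * (v 0 * v 1) + c * v 1 ^ 2) := by
  have h0 := IsForm.coord (0 : Fin 2)
  have h1 := IsForm.coord (1 : Fin 2)
  exact (((h0.pow 2).const_mul a).add ((h0.mul h1).const_mul b)).add ((h1.pow 2).const_mul c)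

/-- A nonnegative ternary quartic that vanishes at `(1, 0, 0)` has degree at most two in the first
variable. -/
theorem IsForm.exists_quadratic_in_first {f : (Fin 3 → ℝ) → ℝ} (hf : IsForm 4 f)
    (h0 : ∀ w, 0 ≤ f w) (he0 : f ![1, 0, 0] = 0) :
    ∃ A G H : (Fin 2 → ℝ) → ℝ, IsForm 2 A ∧ IsForm 3 G ∧ IsForm 4 H ∧ ∀ w,
      f w = w 0 ^ 2 * A (dropFirst w) + 2 * w 0 * G (dropFirst w) + H (dropFirst w) := by
  obtain ⟨c, hc⟩ := hf.exists_quartic_coeffs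
  have c0 : c 0 = 0 := by simpa [hc] using he0
  have c1 : c 1 = 0 := eq_zero_of_forall_cubic_nonneg (b := c 3) (c := c 6) (e := c 10) fun t => by
    have := h0 ![t, 1, 0]
    simp [hc, c0] at this
    linarith
  have c2 : c 2 = 0 := eq_zero_of_forall_cubic_nonneg (b := c 5) (c := c 9) (e := c 14) fun t => by
    have := h0 ![t, 0, 1]
    simp [hc, c0] at this
    linarith
  have x0 := IsForm.coord (0 : Fin 2)
  have x1 := IsForm.coord (1 : Fin 2)
  refine ⟨_, _, _, isForm_binary_quadratic (c 3) (c 4) (c 5),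
    (x0.mul (isForm_binary_quadratic (c 6 / 2) (c 7 / 2) (c 8 / 2))).add
      ((x1.pow 3).const_mul (c 9 / 2)),
    ((x0.pow 2).mul (isForm_binary_quadratic (c 10) (c 11) (c 12))).add
      (((x0.mul (x1.pow 3)).const_mul (c 13)).add ((x1.pow 4).const_mul (c 14))), fun w => ?_⟩
  rw [hc, c0, c1, c2]
  simp
  ring

/-- A nonnegative ternary quartic that vanishes at `(1, 0, 0)` and `(0, 1, 0)` has degree at most
two in each of the first two variables. -/
theorem IsForm.exists_quadratic_in_first_two {f : (Fin 3 → ℝ) → ℝ} (hf : IsForm 4 f)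
    (h0 : ∀ w, 0 ≤ f w) (he0 : f ![1, 0, 0] = 0) (he1 : f ![0, 1, 0] = 0) :
    ∃ A B C : (Fin 2 → ℝ) → ℝ, IsForm 2 A ∧ IsForm 2 B ∧ IsForm 2 C ∧ ∀ w,
      f w = w 0 ^ 2 * A (dropFirst w) + 2 * w 0 * (w 2 * B (dropFirst w))
        + w 2 ^ 2 * C (dropFirst w) := by
  obtain ⟨c, hc⟩ := hf.exists_quartic_coeffs
  have c0 : c 0 = 0 := by simpa [hc] using he0
  have c10 : c 10 = 0 := by simpa [hc] using he1
  have c1 : c 1 = 0 := eq_zero_of_forall_cubic_nonneg (b := c 3) (c := c 6) (e := c 10) fun t => by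
    have := h0 ![t, 1, 0]
    simp [hc, c0] at this
    linarith
  have c2 : c 2 = 0 := eq_zero_of_forall_cubic_nonneg (b := c 5) (c := c 9) (e := c 14) fun t => by
    have := h0 ![t, 0, 1]
    simp [hc, c0] at this
    linarith
  have c6 : c 6 = 0 := eq_zero_of_forall_cubic_nonneg (b := c 3) (c := c 1) (e := c 0) fun t => by
    have := h0 ![1, t, 0]
    simp [hc, c10] at this
    linarith
  have c11 : c 11 = 0 := eq_zero_of_forall_cubic_nonneg (b := c 12) (c := c 13) (e := c 14)
    fun t => by
      have := h0 ![0, t, 1]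
      simp [hc, c10] at this
      linarith
  refine ⟨_, _, _, isForm_binary_quadratic (c 3) (c 4) (c 5),
    isForm_binary_quadratic (c 7 / 2) (c 8 / 2) (c 9 / 2),
    isForm_binary_quadratic (c 12) (c 13) (c 14), fun w => ?_⟩
  rw [hc, c0, c1, c2, c6, c10, c11]
  simp
  ring

/-! ### Ternary quartics dominate squares -/

theorem IsForm.eq_const {n : ℕ} {f : (Fin n → ℝ) → ℝ} (hf : IsForm 0 f) (v : Fin n → ℝ) :
    f v = f 0 := by
  simpa using (hf.map_smul 0 v).symm

theorem IsForm.map_zero {n k : ℕ} {f : (Fin n → ℝ) → ℝ} (hf : IsForm (k + 1) f) : f 0 = 0 := by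
  simpa using hf.map_smul 0 0

theorem IsForm.comp_dropFirst {k : ℕ} {g : (Fin 2 → ℝ) → ℝ} (hg : IsForm k g) :
    IsForm k (fun w : Fin 3 → ℝ => g (dropFirst w)) :=
  hg.comp_linear dropFirst

/-- A nonnegative binary quadratic form with a zero `a ≠ 0` is a multiple of `cross a ^ 2`. -/
theorem IsForm.exists_eq_mul_cross_sq {A : (Fin 2 → ℝ) → ℝ} (hA : IsForm 2 A) (h0 : ∀ v, 0 ≤ A v)
    {a : Fin 2 → ℝ} (ha : a ≠ 0) (hAa : A a = 0) :
    ∃ κ : ℝ, 0 ≤ κ ∧ ∀ v, A v = κ * cross a v ^ 2 := by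
  obtain ⟨g, hg, hAg⟩ := IsForm.exists_eq_cross_mul (k := 1) hA ha hAa
  obtain ⟨k, hk, hgk⟩ := IsForm.exists_eq_cross_mul (k := 0) hg ha
    (eq_zero_of_cross_mul_nonneg hg.continuous ha fun v => hAg v ▸ h0 v)
  have h : ∀ v, A v = k 0 * cross a v ^ 2 := fun v => by
    rw [hAg, hgk, hk.eq_const]
    ring
  refine ⟨k 0, ?_, h⟩
  obtain ⟨v, hv⟩ := exists_cross_ne_zero ha
  have := h0 v
  rw [h] at this
  exact nonneg_of_mul_nonneg_left this (by positivity)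

/-- The case of a quartic `x² A + 2 x G + H` whose leading coefficient `A` is degenerate. If `A = 0`,
then `G = 0` and the quartic is binary. If `A = κ ℓ²` with `κ > 0`, then `G = ℓ g`, and completing
the square gives the quadratic form `κ x ℓ + g`. -/
theorem exists_sq_le_of_degenerate {f : (Fin 3 → ℝ) → ℝ} {A G H : (Fin 2 → ℝ) → ℝ}
    (hA : IsForm 2 A) (hG : IsForm 3 G) (hH : IsForm 4 H) (h0 : ∀ w, 0 ≤ f w)
    (hne : ∃ w, f w ≠ 0)
    (hf : ∀ w, f w = w 0 ^ 2 * A (dropFirst w) + 2 * w 0 * G (dropFirst w) + H (dropFirst w))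
    {a : Fin 2 → ℝ} (ha : a ≠ 0) (hAa : A a = 0) :
    ∃ q : (Fin 3 → ℝ) → ℝ, IsForm 2 q ∧ (∃ x, q x ≠ 0) ∧ ∀ x, q x ^ 2 ≤ f x := by
  have hdisc : ∀ v, 0 ≤ A v ∧ 0 ≤ H v ∧ G v ^ 2 ≤ A v * H v := fun v =>
    sq_le_mul_of_forall_quadratic_nonneg fun x => by
      have := h0 (vecCons x v)
      simpa [hf] using this
  obtain ⟨κ, hκ, hAκ⟩ := hA.exists_eq_mul_cross_sq (fun v => (hdisc v).1) ha hAa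
  rcases hκ.eq_or_lt with rfl | hκ
  · have hA0 : ∀ v, A v = 0 := fun v => by rw [hAκ, zero_mul]
    have hG0 : ∀ v, G v = 0 := fun v => by
      have := (hdisc v).2.2
      rw [hA0, zero_mul] at this
      exact pow_eq_zero_iff two_ne_zero |>.1 (le_antisymm this (sq_nonneg _))
    have hfH : ∀ w, f w = H (dropFirst w) := fun w => by rw [hf, hA0, hG0]; ring
    obtain ⟨w, hw⟩ := hne
    obtain ⟨q, hq, ⟨y, hy⟩, hqH⟩ := dominatesSquare_two 2 H hH (fun v => (hdisc v).2.1)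
      ⟨dropFirst w, hfH w ▸ hw⟩
    exact ⟨_, hq.comp_dropFirst, ⟨vecCons 0 y, by simpa using hy⟩, fun w => hfH w ▸ hqH _⟩
  · have hGa : G a = 0 := by
      have := (hdisc a).2.2
      rw [hAa, zero_mul] at this
      exact pow_eq_zero_iff two_ne_zero |>.1 (le_antisymm this (sq_nonneg _))
    obtain ⟨g, hg, hGg⟩ := IsForm.exists_eq_cross_mul (k := 2) hG ha hGa
    have hres : ∀ v, 0 ≤ κ * H v - g v ^ 2 :=
      nonneg_of_cross_sq_mul_nonneg (by have := hH.continuous; have := hg.continuous; fun_prop) ha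
        fun v => by
          have := (hdisc v).2.2
          rw [hAκ, hGg] at this
          linarith
    have hlin : IsForm 2 fun w : Fin 3 → ℝ => w 0 * cross a (dropFirst w) :=
      (IsForm.coord 0).mul (isForm_cross a).comp_dropFirst
    refine ⟨_, ((hlin.const_mul κ).add hg.comp_dropFirst).const_mul (√κ)⁻¹, ?_, fun w => ?_⟩
    · obtain ⟨v, hv⟩ := exists_cross_ne_zero ha
      by_contra! hall
      have h1 := hall (vecCons 0 v)
      have h2 := hall (vecCons 1 v)
      have hs : √κ ≠ 0 := (Real.sqrt_pos.2 hκ).ne'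
      simp [hs] at h1 h2
      simp [h1, hκ.ne', hv] at h2
    · rw [mul_pow, inv_pow, Real.sq_sqrt hκ.le, inv_mul_le_iff₀ hκ, hf, hAκ, hGg]
      have := hres (dropFirst w)
      linarith

/-- The case of a quartic that vanishes at `(1, 0, 0)` and `(0, 1, 0)`, which has the shape
`x² A + 2 x z B + z² C` with binary quadratic forms `A`, `B`, `C`. If `A` and `A C - B²` are positive
definite, then the quartic dominates a multiple of `z⁴`. If `A C - B²` has a zero `b`, then a shift
of `x` by a multiple of `z` turns `B` and `C` into `ℓ g` and `κ ℓ²`, where `ℓ = cross b`, and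
completing the square gives the quadratic form `κ z ℓ + x g`, or a multiple of `x z` if `κ = 0`. -/
theorem exists_sq_le_of_two_zeros {f : (Fin 3 → ℝ) → ℝ} (hf : IsForm 4 f)
    (h0 : ∀ w, 0 ≤ f w) (hne : ∃ w, f w ≠ 0) (he0 : f ![1, 0, 0] = 0) (he1 : f ![0, 1, 0] = 0) :
    ∃ q : (Fin 3 → ℝ) → ℝ, IsForm 2 q ∧ (∃ x, q x ≠ 0) ∧ ∀ x, q x ^ 2 ≤ f x := by
  obtain ⟨A, B, C, hA, hB, hC, hABC⟩ := hf.exists_quadratic_in_first_two h0 he0 he1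
  have hdisc : ∀ v, 0 ≤ A v ∧ 0 ≤ v 1 ^ 2 * C v ∧ (v 1 * B v) ^ 2 ≤ A v * (v 1 ^ 2 * C v) :=
    fun v => sq_le_mul_of_forall_quadratic_nonneg fun x => by
      have := h0 (vecCons x v)
      simpa [hABC] using this
  by_cases hdeg : ∃ a, a ≠ 0 ∧ A a = 0
  · obtain ⟨a, ha, hAa⟩ := hdeg
    exact exists_sq_le_of_degenerate hA ((IsForm.coord 1).mul hB)
      (((IsForm.coord 1).pow 2).mul hC) h0 hne hABC ha hAa
  push Not at hdeg
  have hApos : ∀ v, v ≠ 0 → 0 < A v := fun v hv => (hdisc v).1.lt_of_ne' (hdeg v hv)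
  have hz : (![-1, 0] : Fin 2 → ℝ) ≠ 0 := fun h => by simpa using congrFun h 0
  have hzc : ∀ v, cross ![-1, 0] v = v 1 := fun v => by simp [cross]
  have hΔ : ∀ v, 0 ≤ A v * C v - B v ^ 2 :=
    nonneg_of_cross_sq_mul_nonneg
      (by have := hA.continuous; have := hB.continuous; have := hC.continuous; fun_prop) hz
      fun v => by
        have := (hdisc v).2.2
        rw [hzc]
        linarith
  have hsq : IsForm 2 (fun v : Fin 2 → ℝ => v 1 ^ 2) := (IsForm.coord 1).pow 2
  have hcoord2 : ∀ w : Fin 3 → ℝ, w 2 = dropFirst w 1 := fun w => rfl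
  by_cases hpos : ∀ v, v ≠ 0 → 0 < A v * C v - B v ^ 2
  · obtain ⟨δ, hδ, H⟩ := ((hA.mul hC).sub (hB.pow 2)).exists_pos_mul_le (hA.mul hsq) hpos
      ⟨by simp, hΔ 0⟩
    refine ⟨_, ((IsForm.coord 2).pow 2).const_mul √δ, ⟨fun _ => 1, ?_⟩, fun w => ?_⟩
    · simp [(Real.sqrt_pos.2 hδ).ne']
    · rw [mul_pow, Real.sq_sqrt hδ.le]
      rcases eq_or_ne (dropFirst w) 0 with hw | hw
      · have : w 2 = 0 := by rw [hcoord2 w, hw]; rfl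
        simpa [this] using h0 w
      · refine le_of_mul_le_mul_left ?_ (hApos _ hw)
        have h1 := mul_le_mul_of_nonneg_left (H (dropFirst w)) (sq_nonneg (w 2))
        simp only [← hcoord2 w] at h1
        rw [hABC]
        -- `A f = (x A + z B)² + z² (A C - B²)`
        nlinarith [sq_nonneg (w 0 * A (dropFirst w) + w 2 * B (dropFirst w))]
  push Not at hpos
  obtain ⟨b, hb, hΔb⟩ := hpos
  have hAb := hApos b hb
  -- Substitute `x = X + α z` so that `B` and `C` become forms that vanish at `b`.
  set α := -B b / A b with hα
  have hB1 : IsForm 2 (fun v => B v + α * A v) := hB.add (hA.const_mul α)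
  have hC1 : IsForm 2 (fun v => C v + 2 * α * B v + α ^ 2 * A v) :=
    (hC.add (hB.const_mul (2 * α))).add (hA.const_mul (α ^ 2))
  have hid : ∀ v, A v * (C v + 2 * α * B v + α ^ 2 * A v) =
      (B v + α * A v) ^ 2 + (A v * C v - B v ^ 2) := fun v => by ring
  have hB1b : B b + α * A b = 0 := by
    rw [hα]
    field_simp
    ring
  have hC1b : C b + 2 * α * B b + α ^ 2 * A b = 0 := by
    have h := hid b
    rw [hB1b, le_antisymm hΔb (hΔ b)] at h
    simpa [hAb.ne'] using h
  have hC1nn : ∀ v, 0 ≤ C v + 2 * α * B v + α ^ 2 * A v := fun v => by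
    rcases eq_or_ne v 0 with rfl | hv
    · exact hC1.map_zero.ge
    · refine nonneg_of_mul_nonneg_right (a := A v) ?_ (hApos v hv)
      rw [hid]
      exact add_nonneg (sq_nonneg _) (hΔ v)
  obtain ⟨κ, hκ, hCκ⟩ := hC1.exists_eq_mul_cross_sq hC1nn hb hC1b
  obtain ⟨g, hg, hBg⟩ := IsForm.exists_eq_cross_mul (k := 1) hB1 hb hB1b
  have hshift : ∀ w, f w = (w 0 - α * w 2) ^ 2 * A (dropFirst w)
      + 2 * (w 0 - α * w 2) * w 2 * (cross b (dropFirst w) * g (dropFirst w))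
      + w 2 ^ 2 * (κ * cross b (dropFirst w) ^ 2) := fun w => by
    rw [hABC, ← hCκ, ← hBg]
    ring
  have hres : ∀ v, 0 ≤ κ * A v - g v ^ 2 :=
    nonneg_of_cross_sq_mul_nonneg (by have := hA.continuous; have := hg.continuous; fun_prop) hb
      fun v => by
        have h1 := hid v
        rw [hCκ, hBg] at h1
        linarith [hΔ v]
  have hX : IsForm 1 (fun w : Fin 3 → ℝ => w 0 - α * w 2) :=
    (IsForm.coord 0).sub ((IsForm.coord 2).const_mul α)
  rcases hκ.eq_or_lt with rfl | hκ
  · have hg0 : ∀ v, g v = 0 := fun v =>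
      pow_eq_zero_iff two_ne_zero |>.1 (le_antisymm (by linarith [hres v]) (sq_nonneg _))
    obtain ⟨ε, hε, H⟩ := hA.exists_pos_mul_le hsq hApos ⟨by simp, (hdisc 0).1⟩
    refine ⟨_, (hX.mul (IsForm.coord 2)).const_mul √ε, ⟨![α + 1, 0, 1], ?_⟩, fun w => ?_⟩
    · simp [(Real.sqrt_pos.2 hε).ne']
    · have h1 := mul_le_mul_of_nonneg_left (H (dropFirst w)) (sq_nonneg (w 0 - α * w 2))
      simp only [← hcoord2 w] at h1
      rw [mul_pow, Real.sq_sqrt hε.le, hshift, hg0]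
      linarith
  · have hzl : IsForm 2 fun w : Fin 3 → ℝ => w 2 * cross b (dropFirst w) :=
      (IsForm.coord 2).mul (isForm_cross b).comp_dropFirst
    refine ⟨_, ((hzl.const_mul κ).add (hX.mul hg.comp_dropFirst)).const_mul (√κ)⁻¹, ?_,
      fun w => ?_⟩
    · obtain ⟨v, hv⟩ := exists_cross_ne_zero hb
      by_contra! hall
      have hs : √κ ≠ 0 := (Real.sqrt_pos.2 hκ).ne'
      have h1 : ∀ u : Fin 2 → ℝ, u 1 * cross b u = 0 := fun u => by
        have := hall (vecCons (α * u 1) u)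
        simp [hs, hκ.ne'] at this
        rcases this with h | h <;> simp [h]
      have h2 := nonneg_of_cross_sq_mul_nonneg (g := fun u => -cross b u ^ 2)
        (by have := (isForm_cross b).continuous; fun_prop) hz
        (fun u => by rw [hzc]; nlinarith [h1 u]) v
      exact hv (pow_eq_zero_iff two_ne_zero |>.1 (le_antisymm (by linarith) (sq_nonneg _)))
    · rw [mul_pow, inv_pow, Real.sq_sqrt hκ.le, inv_mul_le_iff₀ hκ, hshift]
      have := mul_nonneg (sq_nonneg (w 0 - α * w 2)) (hres (dropFirst w))
      linarith

theorem exists_sq_le_comp_linearEquiv {n k d : ℕ} {f : (Fin n → ℝ) → ℝ}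
    (T : (Fin n → ℝ) ≃ₗ[ℝ] (Fin n → ℝ)) (hf : IsForm k f) (h0 : ∀ w, 0 ≤ f w)
    (hne : ∃ w, f w ≠ 0)
    (h : IsForm k (fun w => f (T w)) → (∀ w, 0 ≤ f (T w)) → (∃ w, f (T w) ≠ 0) →
      ∃ q : (Fin n → ℝ) → ℝ, IsForm d q ∧ (∃ x, q x ≠ 0) ∧ ∀ x, q x ^ 2 ≤ f (T x)) :
    ∃ q : (Fin n → ℝ) → ℝ, IsForm d q ∧ (∃ x, q x ≠ 0) ∧ ∀ x, q x ^ 2 ≤ f x := by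
  obtain ⟨w, hw⟩ := hne
  obtain ⟨q, hq, ⟨x, hx⟩, hle⟩ := h (hf.comp_linear T.toLinearMap) (fun w => h0 _)
    ⟨T.symm w, by simpa using hw⟩
  refine ⟨_, hq.comp_linear T.symm.toLinearMap, ⟨T x, by simpa using hx⟩, fun y => ?_⟩
  simpa using hle (T.symm y)

/-- The case of a quartic `x² A + 2 x G + H` that vanishes at `(1, 0, 0)`. If `A` and
`A H - G²` are positive definite, then `A H - G² ≥ δ A³` for some `δ > 0`, and the quartic dominates
`δ A²`. If `A H - G²` vanishes at `b`, then so does the quartic at the point `(-G b / A b, b)`. -/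
theorem exists_sq_le_of_zero {f : (Fin 3 → ℝ) → ℝ} (hf : IsForm 4 f)
    (h0 : ∀ w, 0 ≤ f w) (hne : ∃ w, f w ≠ 0) (he0 : f ![1, 0, 0] = 0) :
    ∃ q : (Fin 3 → ℝ) → ℝ, IsForm 2 q ∧ (∃ x, q x ≠ 0) ∧ ∀ x, q x ^ 2 ≤ f x := by
  obtain ⟨A, G, H, hA, hG, hH, hAGH⟩ := hf.exists_quadratic_in_first h0 he0
  have hdisc : ∀ v, 0 ≤ A v ∧ 0 ≤ H v ∧ G v ^ 2 ≤ A v * H v := fun v =>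
    sq_le_mul_of_forall_quadratic_nonneg fun x => by
      have := h0 (vecCons x v)
      simpa [hAGH] using this
  by_cases hdeg : ∃ a, a ≠ 0 ∧ A a = 0
  · obtain ⟨a, ha, hAa⟩ := hdeg
    exact exists_sq_le_of_degenerate hA hG hH h0 hne hAGH ha hAa
  push Not at hdeg
  have hApos : ∀ v, v ≠ 0 → 0 < A v := fun v hv => (hdisc v).1.lt_of_ne' (hdeg v hv)
  have hA0 : A 0 = 0 := hA.map_zero
  by_cases hpos : ∀ v, v ≠ 0 → 0 < A v * H v - G v ^ 2
  · obtain ⟨δ, hδ, hle⟩ := ((hA.mul hH).sub (hG.pow 2)).exists_pos_mul_le (hA.pow 3) hpos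
      ⟨by simp [hA0], sub_nonneg.2 (hdisc 0).2.2⟩
    refine ⟨_, hA.comp_dropFirst.const_mul √δ, ⟨![0, 1, 0], ?_⟩, fun w => ?_⟩
    · have h1 : (![1, 0] : Fin 2 → ℝ) ≠ 0 := fun h => by simpa using congrFun h 0
      have := hApos _ h1
      simp [(Real.sqrt_pos.2 hδ).ne', this.ne']
    · rw [mul_pow, Real.sq_sqrt hδ.le]
      rcases eq_or_ne (dropFirst w) 0 with hw | hw
      · simpa [hw, hA0] using h0 w
      · refine le_of_mul_le_mul_left ?_ (hApos _ hw)
        rw [hAGH]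
        -- `A f = (x A + G)² + (A H - G²)`
        nlinarith [sq_nonneg (w 0 * A (dropFirst w) + G (dropFirst w)), hle (dropFirst w)]
  push Not at hpos
  obtain ⟨b, hb, hΔb⟩ := hpos
  have hAb := hApos b hb
  have hN := sq_add_sq_pos_of_ne_zero hb
  set α := -G b / A b with hα
  have hfb : f (vecCons α b) = 0 := by
    have h1 : A b * H b - G b ^ 2 = 0 := le_antisymm hΔb (sub_nonneg.2 (hdisc b).2.2)
    have h2 : A b * f (vecCons α b) = 0 := by
      have h3 : α * A b = -G b := by rw [hα]; field_simp
      simp only [hAGH, dropFirst_cons, cons_val_zero]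
      linear_combination (α * A b + G b) * h3 + h1
    simpa [hAb.ne'] using h2
  -- The substitution fixes `(1, 0, 0)` and maps `(0, 1, 0)` to the second zero.
  set N := b 0 ^ 2 + b 1 ^ 2 with hNdef
  let T : (Fin 3 → ℝ) ≃ₗ[ℝ] (Fin 3 → ℝ) :=
    LinearEquiv.ofLinearMap
      (Matrix.mulVecLin !![1, α, 0; 0, b 0, -b 1; 0, b 1, b 0])
      (Matrix.mulVecLin !![1, -α * b 0 / N, -α * b 1 / N; 0, b 0 / N, b 1 / N;
        0, -b 1 / N, b 0 / N])
      (by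
        ext j i
        fin_cases i <;> fin_cases j <;>
          simp [Matrix.mulVec, dotProduct, Fin.sum_univ_three] <;> field_simp <;>
          (try rw [hNdef]) <;> ring)
      (by
        ext j i
        fin_cases i <;> fin_cases j <;>
          simp [Matrix.mulVec, dotProduct, Fin.sum_univ_three] <;> field_simp <;>
          (try rw [hNdef]) <;> ring)
  have hT0 : T ![1, 0, 0] = ![1, 0, 0] := by
    ext i
    fin_cases i <;> simp [T, Matrix.mulVec, dotProduct, Fin.sum_univ_three]
  have hT1 : T ![0, 1, 0] = vecCons α b := by
    ext i
    fin_cases i <;> simp [T, Matrix.mulVec, dotProduct, Fin.sum_univ_three]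
  exact exists_sq_le_comp_linearEquiv T hf h0 hne fun h1 h2 h3 =>
    exists_sq_le_of_two_zeros h1 h2 h3 (by rw [hT0, he0]) (by rw [hT1, hfb])

/-- The case of ternary quartics: a nontrivial zero is moved to `(1, 0, 0)`. -/
theorem dominatesSquare_three_two : DominatesSquare 3 2 := by
  intro f hf h0 hne
  by_cases hpos : ∀ x, x ≠ 0 → 0 < f x
  · exact exists_sq_le_of_pos hf h0 hne hpos
  push Not at hpos
  obtain ⟨u, hu, hfu⟩ := hpos
  have he : (![1, 0, 0] : Fin 3 → ℝ) ≠ 0 := fun h => by simpa using congrFun h 0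
  obtain ⟨T, hT⟩ := SeparatingDual.exists_continuousLinearEquiv_apply_eq (R := ℝ) he hu
  exact exists_sq_le_comp_linearEquiv T.toLinearEquiv hf h0 hne fun h1 h2 h3 =>
    exists_sq_le_of_zero h1 h2 h3 (by
      have : T.toLinearEquiv ![1, 0, 0] = u := hT
      rw [this]
      exact le_antisymm hfu (h0 u))

/-! ### Duality between moment matrices and nonnegative forms -/

/-- The coefficient vector of the square of the form with coefficient vector `p`. -/
def sqCoeff {m d : ℕ} (p : Expo m d → ℝ) : Expo m (2 * d) → ℝ :=
  fun γ => ∑ α, ∑ β, if Expo.add α β = γ then p α * p β else 0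

theorem sqCoeff_dotProduct {m d : ℕ} (p : Expo m d → ℝ) (y : Expo m (2 * d) → ℝ) :
    sqCoeff p ⬝ᵥ y = p ⬝ᵥ (momentMatrix y *ᵥ p) := by
  simp only [dotProduct, sqCoeff, mulVec, momentMatrix, Matrix.of_apply, Finset.sum_mul,
    Finset.mul_sum]
  rw [Finset.sum_comm]
  refine Finset.sum_congr rfl fun α _ => ?_
  rw [Finset.sum_comm]
  refine Finset.sum_congr rfl fun β _ => ?_
  rw [Finset.sum_eq_single (Expo.add α β)]
  · simp
    ring
  · intro γ _ hγ
    simp [hγ.symm]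
  · simp

theorem sqCoeff_dotProduct_nonneg {m d : ℕ} (p : Expo m d → ℝ) {y : Expo m (2 * d) → ℝ}
    (hy : (momentMatrix y).PosSemidef) : 0 ≤ sqCoeff p ⬝ᵥ y := by
  rw [sqCoeff_dotProduct]
  simpa using hy.dotProduct_mulVec_nonneg p

theorem sqCoeff_dotProduct_zeta {m d : ℕ} (p : Expo m d → ℝ) (x : Fin (m + 1) → ℝ) :
    sqCoeff p ⬝ᵥ zeta (2 * d) x = (p ⬝ᵥ zeta d x) ^ 2 := by
  rw [sqCoeff_dotProduct, sq]
  simp only [dotProduct, mulVec, momentMatrix, Matrix.of_apply, zeta_add, Finset.sum_mul,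
    Finset.mul_sum]
  rw [Finset.sum_comm]
  refine Finset.sum_congr rfl fun α _ => Finset.sum_congr rfl fun β _ => ?_
  ring

theorem posSemidef_momentMatrix_zeta {m d : ℕ} (x : Fin (m + 1) → ℝ) :
    (momentMatrix (zeta (2 * d) x)).PosSemidef := by
  refine Matrix.PosSemidef.of_dotProduct_mulVec_nonneg ?_ fun p => ?_
  · ext α β
    simp [momentMatrix, zeta_add, mul_comm]
  · rw [star_trivial, ← sqCoeff_dotProduct, sqCoeff_dotProduct_zeta]
    exact sq_nonneg _

theorem momentMatrix_add {m d : ℕ} (y z : Expo m (2 * d) → ℝ) :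
    momentMatrix (y + z) = momentMatrix y + momentMatrix z := rfl

theorem momentMatrix_smul {m d : ℕ} (c : ℝ) (y : Expo m (2 * d) → ℝ) :
    momentMatrix (c • y) = c • momentMatrix y := rfl

/-- The sum of the values at finitely many points that determine the forms of degree `k` is a
linear functional that is positive on the nonzero nonnegative forms. -/
theorem exists_strictly_positive_functional (m k : ℕ) :
    ∃ z : Expo m k → ℝ, ∀ F : Expo m k → ℝ, (∀ x, 0 ≤ F ⬝ᵥ zeta k x) → F ≠ 0 → 0 < F ⬝ᵥ z := by
  classical
  obtain ⟨t, hts, ht⟩ := (Submodule.fg_span_iff_fg_span_finset_subset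
    (Set.range (zeta (m := m) k))).1 (IsNoetherian.noetherian (R := ℝ) _)
  have hval : ∀ v ∈ t, ∃ x, zeta k x = v := fun v hv => hts hv
  refine ⟨∑ v ∈ t, v, fun F hF hne => ?_⟩
  rw [dotProduct_sum]
  have hnn : ∀ v ∈ t, 0 ≤ F ⬝ᵥ v := fun v hv => by
    obtain ⟨x, rfl⟩ := hval v hv
    exact hF x
  refine Finset.sum_pos' hnn ?_
  by_contra! h
  refine hne (coeff_eq_zero_of_forall_dotProduct_zeta fun x => ?_)
  have hx : zeta k x ∈ Submodule.span ℝ (t : Set (Expo m k → ℝ)) :=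
    ht ▸ Submodule.subset_span (Set.mem_range_self x)
  generalize zeta k x = u at hx ⊢
  induction hx using Submodule.span_induction with
  | mem v hv => exact le_antisymm (h v hv) (hnn v hv)
  | zero => exact dotProduct_zero F
  | add u v _ _ hu hv => rw [dotProduct_add, hu, hv, add_zero]
  | smul c v _ hv => rw [dotProduct_smul, hv, smul_zero]

/-- If every nonzero nonnegative form dominates a nonzero square, then a vector with positive
semidefinite moment matrix pairs nonnegatively with every nonnegative form. Consider the nonnegative
form at which the ratio of this pairing to a strictly positive functional is least. If the ratio is
negative, then subtracting the square makes it smaller. -/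
theorem DominatesSquare.dotProduct_nonneg {m d : ℕ} (H : DominatesSquare (m + 1) d)
    {y : Expo m (2 * d) → ℝ} (hy : (momentMatrix y).PosSemidef) {F : Expo m (2 * d) → ℝ}
    (hF : ∀ x, 0 ≤ F ⬝ᵥ zeta (2 * d) x) : 0 ≤ F ⬝ᵥ y := by
  obtain ⟨z, hz⟩ := exists_strictly_positive_functional m (2 * d)
  by_contra! hneg
  have hcont : ∀ u : Expo m (2 * d) → ℝ, Continuous fun G : Expo m (2 * d) → ℝ => G ⬝ᵥ u :=
    fun u => by unfold dotProduct; fun_prop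
  set K : Set (Expo m (2 * d) → ℝ) :=
    Metric.sphere 0 1 ∩ {G | ∀ x, 0 ≤ G ⬝ᵥ zeta (2 * d) x} with hK
  have hKc : IsCompact K := by
    refine (isCompact_sphere 0 1).inter_right ?_
    rw [Set.ofPred_forall]
    exact isClosed_iInter fun x => isClosed_le continuous_const (hcont _)
  have hscale : ∀ G : Expo m (2 * d) → ℝ, G ≠ 0 → (∀ x, 0 ≤ G ⬝ᵥ zeta (2 * d) x) →
      ‖G‖⁻¹ • G ∈ K := fun G hG hpos => by
    have hn : 0 < ‖G‖ := norm_pos_iff.2 hG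
    refine ⟨by simp [norm_smul, hn.ne'], fun x => ?_⟩
    rw [smul_dotProduct]
    exact smul_nonneg (by positivity) (hpos x)
  have hzK : ∀ G ∈ K, 0 < G ⬝ᵥ z := fun G hG =>
    hz G hG.2 fun h => by simpa [h] using hG.1
  have hF0 : F ≠ 0 := fun h => by simp [h] at hneg
  obtain ⟨G, hG, hmin⟩ := hKc.exists_isMinOn ⟨_, hscale F hF0 hF⟩
    (f := fun G => (G ⬝ᵥ y) / (G ⬝ᵥ z))
    ((hcont y).continuousOn.div (hcont z).continuousOn fun G hG => (hzK G hG).ne')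
  set c := (G ⬝ᵥ y) / (G ⬝ᵥ z) with hc
  have hall : ∀ E : Expo m (2 * d) → ℝ, (∀ x, 0 ≤ E ⬝ᵥ zeta (2 * d) x) →
      c * (E ⬝ᵥ z) ≤ E ⬝ᵥ y := fun E hE => by
    rcases eq_or_ne E 0 with rfl | hE0
    · simp
    have hn : 0 < ‖E‖⁻¹ := inv_pos.2 (norm_pos_iff.2 hE0)
    have h1 : c ≤ _ := hmin (hscale E hE0 hE)
    simp only [smul_dotProduct, smul_eq_mul] at h1
    rwa [mul_div_mul_left _ _ hn.ne', le_div_iff₀ (hz E hE hE0)] at h1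
  have hcneg : c < 0 := by
    have h1 := hall F hF
    by_contra! h2
    have := mul_nonneg h2 (hz F hF hF0).le
    linarith
  have hG0 : ∃ x, G ⬝ᵥ zeta (2 * d) x ≠ 0 := by
    by_contra! h
    have h1 := hG.1
    rw [coeff_eq_zero_of_forall_dotProduct_zeta h] at h1
    simp at h1
  obtain ⟨q, hq, ⟨x₀, hx₀⟩, hle⟩ := H _ (isForm_dotProduct_zeta G) hG.2 hG0
  obtain ⟨p, hp⟩ := hq.exists_coeff
  have hsq : ∀ x, sqCoeff p ⬝ᵥ zeta (2 * d) x = q x ^ 2 := fun x => by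
    rw [sqCoeff_dotProduct_zeta, hp]
  have h1 := hall (G - sqCoeff p) fun x => by
    rw [sub_dotProduct, hsq]
    exact sub_nonneg.2 (hle x)
  have h2 : 0 < sqCoeff p ⬝ᵥ z := hz _ (fun x => by rw [hsq]; positivity) fun h => by
    have := hsq x₀
    rw [h, zero_dotProduct] at this
    exact hx₀ (pow_eq_zero_iff two_ne_zero |>.1 this.symm)
  have h3 := sqCoeff_dotProduct_nonneg p hy
  have h4 : G ⬝ᵥ y = c * (G ⬝ᵥ z) := by
    rw [hc, div_mul_cancel₀ _ (hzK G hG).ne']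
  rw [sub_dotProduct, sub_dotProduct, h4] at h1
  nlinarith [mul_pos (neg_pos.2 hcneg) h2]

/-! ### Vectors with positive semidefinite moment matrix -/

/-- By Carathéodory's theorem, the convex hull of a compact set in a finite-dimensional space is a
finite union of continuous images of compact sets. -/
theorem isCompact_convexHull_of_finiteDimensional {E : Type*} [NormedAddCommGroup E]
    [NormedSpace ℝ E] [FiniteDimensional ℝ E] {s : Set E} (hs : IsCompact s) :
    IsCompact (convexHull ℝ s) := by
  have hunion : convexHull ℝ s = ⋃ k ∈ Finset.range (Module.finrank ℝ E + 2),
      (fun p : (Fin k → ℝ) × (Fin k → E) => ∑ i, p.1 i • p.2 i) ''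
        (stdSimplex ℝ (Fin k) ×ˢ Set.univ.pi fun _ => s) := by
    apply Set.Subset.antisymm
    · intro x hx
      obtain ⟨ι, _, z, w, hz, hind, hw, hw1, hx⟩ := eq_pos_convex_span_of_mem_convexHull hx
      have hcard : Fintype.card ι < Module.finrank ℝ E + 2 := by
        have h1 := hind.card_le_finrank_succ
        have h2 := Submodule.finrank_le (vectorSpan ℝ (Set.range z))
        omega
      let e := (Fintype.equivFin ι).symm
      refine Set.mem_iUnion₂.2 ⟨Fintype.card ι, Finset.mem_range.2 hcard, (w ∘ e, z ∘ e),
        ⟨⟨fun i => (hw _).le, ?_⟩, fun i _ => hz (Set.mem_range_self _)⟩, ?_⟩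
      · rw [← hw1]
        exact e.sum_comp w
      · rw [← hx]
        exact e.sum_comp fun i => w i • z i
    · refine Set.iUnion₂_subset fun k _ => ?_
      rintro _ ⟨⟨w, z⟩, ⟨hw, hz⟩, rfl⟩
      exact mem_convexHull_of_exists_fintype w z hw.1 hw.2 (fun i => hz i (Set.mem_univ i)) rfl
  rw [hunion]
  refine Finset.isCompact_biUnion _ fun k _ => ?_
  refine ((isCompact_stdSimplex ℝ (Fin k)).prod (isCompact_univ_pi fun _ => hs)).image ?_
  fun_prop

/-- The Euclidean unit sphere of `ℝ^(m+1)`. -/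
def unitSphere (m : ℕ) : Set (Fin (m + 1) → ℝ) := {x | ∑ i, x i ^ 2 = 1}

theorem isCompact_unitSphere (m : ℕ) : IsCompact (unitSphere m) := by
  refine (isCompact_closedBall (0 : Fin (m + 1) → ℝ) 1).of_isClosed_subset
    (isClosed_eq (by fun_prop) continuous_const) fun x hx => ?_
  rw [mem_closedBall_zero_iff, pi_norm_le_iff_of_nonneg zero_le_one]
  intro i
  rw [Real.norm_eq_abs, ← sq_le_one_iff_abs_le_one, ← show ∑ i, x i ^ 2 = 1 from hx]
  exact Finset.single_le_sum (f := fun i => x i ^ 2) (fun j _ => sq_nonneg _) (Finset.mem_univ i)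

theorem ne_zero_of_mem_unitSphere {m : ℕ} {x : Fin (m + 1) → ℝ} (hx : x ∈ unitSphere m) :
    x ≠ 0 := by
  rintro rfl
  simp [unitSphere] at hx

theorem IsForm.nonneg_of_nonneg_on_unitSphere {m k : ℕ} {f : (Fin (m + 1) → ℝ) → ℝ}
    (hf : IsForm k f) (h : ∀ x ∈ unitSphere m, 0 ≤ f x) (x : Fin (m + 1) → ℝ) : 0 ≤ f x := by
  have hne : ∀ x, x ≠ 0 → 0 ≤ f x := fun x hx => by
    have hpos : 0 < ∑ i, x i ^ 2 := by
      obtain ⟨i, hi⟩ := Function.ne_iff.1 hx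
      exact Finset.sum_pos' (fun _ _ => sq_nonneg _) ⟨i, Finset.mem_univ i, sq_pos_of_ne_zero hi⟩
    set r := √(∑ i, x i ^ 2) with hr
    have hr0 : 0 < r := Real.sqrt_pos.2 hpos
    have hmem : r⁻¹ • x ∈ unitSphere m := by
      simp only [unitSphere, Set.mem_ofPred_eq, Pi.smul_apply, smul_eq_mul, mul_pow,
        ← Finset.mul_sum]
      rw [inv_pow, hr, Real.sq_sqrt hpos.le, inv_mul_cancel₀ hpos.ne']
    have hx' : x = r • (r⁻¹ • x) := by rw [smul_smul, mul_inv_cancel₀ hr0.ne', one_smul]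
    rw [hx', hf.map_smul]
    exact mul_nonneg (pow_nonneg hr0.le k) (h _ hmem)
  rcases eq_or_ne x 0 with rfl | hx
  · have := hf.continuous
    have h1 := nonneg_of_forall_pos_nonneg (φ := fun t => f (t • fun _ => 1)) (by fun_prop)
      fun t ht => hne _ fun h => ht.ne' (by simpa using congrFun h 0)
    simpa using h1
  · exact hne x hx

theorem continuous_zeta {m : ℕ} (k : ℕ) : Continuous (zeta (m := m) k) := by
  unfold zeta
  fun_prop

/-- If nonnegative forms of degree `2 * d` dominate squares, then every vector with positive
semidefinite moment matrix is a nonnegative multiple of a convex combination of vectors of monomials.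
The scaling is fixed by the form `(∑ x i ^ 2) ^ d`, and a hyperplane that separates the scaled vector
from the compact convex hull would be a nonnegative form with a negative pairing. -/
theorem DominatesSquare.exists_eq_smul_mem_convexHull {m d : ℕ} (H : DominatesSquare (m + 1) d)
    {y : Expo m (2 * d) → ℝ} (hy : (momentMatrix y).PosSemidef) :
    ∃ t : ℝ, 0 ≤ t ∧ ∃ b ∈ convexHull ℝ (zeta (2 * d) '' unitSphere m), y = t • b := by
  have hE : IsForm (2 * d) (fun x : Fin (m + 1) → ℝ => (∑ i, x i ^ 2) ^ d) :=
    (IsForm.sum Finset.univ fun i _ => (IsForm.coord i).pow 2).pow d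
  obtain ⟨e, he⟩ := hE.exists_coeff
  have heS : ∀ x ∈ unitSphere m, e ⬝ᵥ zeta (2 * d) x = 1 := fun x hx => by
    rw [← he, show ∑ i, x i ^ 2 = 1 from hx, one_pow]
  have hpair : ∀ F : Expo m (2 * d) → ℝ, (∀ x ∈ unitSphere m, 0 ≤ F ⬝ᵥ zeta (2 * d) x) →
      0 ≤ F ⬝ᵥ y := fun F hF =>
    H.dotProduct_nonneg hy ((isForm_dotProduct_zeta F).nonneg_of_nonneg_on_unitSphere hF)
  have hcompact : IsCompact (convexHull ℝ (zeta (2 * d) '' unitSphere m)) :=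
    isCompact_convexHull_of_finiteDimensional
      ((isCompact_unitSphere m).image (continuous_zeta _))
  have hS : (Pi.single 0 1 : Fin (m + 1) → ℝ) ∈ unitSphere m := by
    simp [unitSphere, Pi.single_apply]
  have ht : 0 ≤ e ⬝ᵥ y := hpair e fun x hx => by rw [heS x hx]; exact zero_le_one
  rcases ht.eq_or_lt with ht | ht
  · -- Every form is bounded on the sphere by a multiple of `e`, hence pairs to zero with `y`.
    have hnn : ∀ F : Expo m (2 * d) → ℝ, 0 ≤ F ⬝ᵥ y := fun F => by
      obtain ⟨C, hC⟩ := (isCompact_unitSphere m).exists_bound_of_continuousOn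
        (isForm_dotProduct_zeta F).continuous.continuousOn
      have h1 := hpair (C • e + F) fun x hx => by
        rw [add_dotProduct, smul_dotProduct, heS x hx, smul_eq_mul, mul_one]
        have := (abs_le.1 (hC x hx)).1
        linarith
      rwa [add_dotProduct, smul_dotProduct, ← ht, smul_zero, zero_add] at h1
    have hyy : y ⬝ᵥ y = 0 := by
      have h1 := hnn (-y)
      rw [neg_dotProduct] at h1
      linarith [hnn y]
    exact ⟨0, le_rfl, _, subset_convexHull ℝ _ (Set.mem_image_of_mem _ hS),
      by rw [zero_smul, dotProduct_self_eq_zero.1 hyy]⟩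
  · refine ⟨e ⬝ᵥ y, ht.le, (e ⬝ᵥ y)⁻¹ • y, ?_, by rw [smul_smul, mul_inv_cancel₀ ht.ne', one_smul]⟩
    by_contra hnot
    obtain ⟨φ, u, hφy, hφ⟩ := geometric_hahn_banach_point_closed (convex_convexHull ℝ _)
      hcompact.isClosed hnot
    set F : Expo m (2 * d) → ℝ := fun α => φ (Pi.single α 1) with hF
    have hφF : ∀ v, φ v = F ⬝ᵥ v := fun v => by
      have := φ.toLinearMap.pi_apply_eq_sum_univ v
      simp only [ContinuousLinearMap.coe_coe, smul_eq_mul] at this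
      rw [this]
      refine Finset.sum_congr rfl fun α _ => ?_
      rw [mul_comm, hF]
      refine congrArg (φ · * v α) (funext fun β => ?_)
      simp [Pi.single_apply, eq_comm]
    have h1 := hpair (F - u • e) fun x hx => by
      rw [sub_dotProduct, smul_dotProduct, heS x hx, ← hφF, smul_eq_mul, mul_one]
      exact sub_nonneg.2 (hφ _ (subset_convexHull ℝ _ (Set.mem_image_of_mem _ hx))).le
    rw [sub_dotProduct, smul_dotProduct, ← hφF, smul_eq_mul] at h1
    rw [map_smul, smul_eq_mul, inv_mul_lt_iff₀ ht] at hφy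
    linarith

/-! ### Convex sets in the oriented projective space -/

section Rays

variable {E : Type*} [AddCommGroup E] [Module ℝ E]

theorem exists_pos_smul_of_ray_eq {u v : E} {hu : u ≠ 0} {hv : v ≠ 0}
    (h : rayOfNeZero ℝ u hu = rayOfNeZero ℝ v hv) : ∃ r : ℝ, 0 < r ∧ u = r • v :=
  ((ray_eq_iff hu hv).1 h).exists_pos_right hu hv

theorem conv_subset {S T : Set (Module.Ray ℝ E)} (h : S ⊆ T) (hT : IsConvex T) : conv S ⊆ T :=
  Set.sInter_subset_of_mem ⟨h, hT⟩

theorem ray_mem_nonnegPart_iff {ι : Type*} {i : ι} {v : ι → ℝ} (hv : v ≠ 0) :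
    rayOfNeZero ℝ v hv ∈ nonnegPart i ↔ 0 ≤ v i := by
  refine ⟨?_, fun h => ⟨v, hv, rfl, h⟩⟩
  rintro ⟨u, hu, hvu, h⟩
  obtain ⟨r, hr, rfl⟩ := exists_pos_smul_of_ray_eq hvu
  exact mul_nonneg hr.le h

theorem isConvex_nonnegPart {ι : Type*} (i : ι) : IsConvex (nonnegPart i) := by
  rintro u v w hu hv hw hu' hv' ⟨a, b, ha, hb, -, rfl⟩
  rw [ray_mem_nonnegPart_iff] at hu' hv' ⊢
  exact add_nonneg (mul_nonneg ha hu') (mul_nonneg hb hv')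

/-- The vectors whose image under a linear map is zero or represents a point of a convex set of the
oriented projective space form a convex set. -/
theorem IsConvex.convex_preimage {V : Type*} [AddCommGroup V] [Module ℝ V]
    {T : Set (Module.Ray ℝ E)} (hT : IsConvex T) (φ : V →ₗ[ℝ] E) :
    Convex ℝ {v | ∀ h : φ v ≠ 0, rayOfNeZero ℝ (φ v) h ∈ T} := by
  intro u hu v hv a b ha hb hab hw
  have hscale : ∀ {c : ℝ} {x : V}, 0 ≤ c → (∀ h : φ x ≠ 0, rayOfNeZero ℝ (φ x) h ∈ T) →
      ∀ h : c • φ x ≠ 0, rayOfNeZero ℝ (c • φ x) h ∈ T := fun {c x} hc hx h => by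
    have hc0 : c ≠ 0 := fun h0 => h (by rw [h0, zero_smul])
    have hx0 : φ x ≠ 0 := fun h0 => h (by rw [h0, smul_zero])
    rw [ray_pos_smul hx0 (hc.lt_of_ne' hc0) h]
    exact hx hx0
  have hφ : φ (a • u + b • v) = a • φ u + b • φ v := by simp
  simp only [hφ] at hw ⊢
  by_cases hu0 : φ u = 0
  · simp only [hu0, smul_zero, zero_add] at hw ⊢
    exact hscale hb hv hw
  by_cases hv0 : φ v = 0
  · simp only [hv0, smul_zero, add_zero] at hw ⊢
    exact hscale ha hu hw
  exact hT _ _ _ hu0 hv0 hw (hu hu0) (hv hv0) ⟨a, b, ha, hb, hab, rfl⟩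

end Rays

/-! ### The convex hull of the variety -/

section MomentImage

variable {m n d : ℕ}

theorem Expo.add_first (m d : ℕ) :
    Expo.add (Expo.first m d) (Expo.first m d) = Expo.first m (2 * d) := by
  refine Subtype.ext (funext fun i => ?_)
  rcases eq_or_ne i 0 with rfl | hi
  · simp [Expo.add, Expo.first, two_mul]
  · simp [Expo.add, Expo.first, hi]

/-- The condition on the first coordinate is automatic, because this coordinate is a diagonal entry
of the moment matrix. -/
theorem ray_mulVec_mem_momentImage {A : Matrix (Fin (n + 1)) (Expo m (2 * d)) ℝ}
    {y : Expo m (2 * d) → ℝ} (hy : (momentMatrix y).PosSemidef) (h : A *ᵥ y ≠ 0) :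
    rayOfNeZero ℝ (A *ᵥ y) h ∈ momentImage A := by
  have hy0 : y ≠ 0 := fun h0 => h (by rw [h0, mulVec_zero])
  refine ⟨y, hy0, (ray_mem_nonnegPart_iff hy0).2 ?_, hy, h, rfl⟩
  have := hy.diag_nonneg (i := Expo.first m d)
  rwa [momentMatrix, Matrix.of_apply, Expo.add_first] at this

theorem variety_subset_momentImage (A : Matrix (Fin (n + 1)) (Expo m (2 * d)) ℝ) :
    variety A ⊆ momentImage A := by
  rintro _ ⟨x, -, h, rfl⟩
  exact ray_mulVec_mem_momentImage (posSemidef_momentMatrix_zeta x) h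

theorem isConvex_momentImage (A : Matrix (Fin (n + 1)) (Expo m (2 * d)) ℝ) :
    IsConvex (momentImage A) := by
  rintro u v w hu hv hw ⟨y, -, -, hy, hy0, hyu⟩ ⟨z, -, -, hz, hz0, hzv⟩ ⟨a, b, ha, hb, -, rfl⟩
  obtain ⟨r, hr, rfl⟩ := exists_pos_smul_of_ray_eq hyu
  obtain ⟨s, hs, rfl⟩ := exists_pos_smul_of_ray_eq hzv
  have heq : a • r • A *ᵥ y + b • s • A *ᵥ z = A *ᵥ ((a * r) • y + (b * s) • z) := by
    simp [mulVec_add, mulVec_smul, smul_smul]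
  simp only [heq] at hw ⊢
  refine ray_mulVec_mem_momentImage ?_ hw
  rw [momentMatrix_add, momentMatrix_smul, momentMatrix_smul]
  exact (hy.smul (mul_nonneg ha hr.le)).add (hz.smul (mul_nonneg hb hs.le))

theorem DominatesSquare.conv_variety_eq (H : DominatesSquare (m + 1) d)
    (A : Matrix (Fin (n + 1)) (Expo m (2 * d)) ℝ) : conv (variety A) = momentImage A := by
  refine (conv_subset (variety_subset_momentImage A) (isConvex_momentImage A)).antisymm ?_
  rintro _ ⟨y, -, -, hy, h, rfl⟩
  refine Set.mem_sInter.2 fun T ⟨hVT, hT⟩ => ?_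
  obtain ⟨t, ht, b, hb, rfl⟩ := H.exists_eq_smul_mem_convexHull hy
  have hsub : zeta (2 * d) '' unitSphere m ⊆
      {v | ∀ h : A.mulVecLin v ≠ 0, rayOfNeZero ℝ (A.mulVecLin v) h ∈ T} := by
    rintro _ ⟨x, hx, rfl⟩ h
    exact hVT ⟨x, ne_zero_of_mem_unitSphere hx, h, rfl⟩
  have hbT := convexHull_min hsub (hT.convex_preimage A.mulVecLin) hb
  have hAb : A *ᵥ b ≠ 0 := fun h0 => h (by rw [mulVec_smul, h0, smul_zero])
  have ht0 : t ≠ 0 := fun h0 => h (by rw [h0, zero_smul, mulVec_zero])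
  simp only [mulVec_smul] at h ⊢
  rw [ray_pos_smul hAb (ht.lt_of_ne' ht0) h]
  exact hbT hAb

theorem isSemidefiniteRepresentable_momentImage (A : Matrix (Fin (n + 1)) (Expo m (2 * d)) ℝ) :
    IsSemidefiniteRepresentable (momentImage A) := by
  let e := Fintype.equivFin (Expo m d)
  let Φ : (Expo m (2 * d) → ℝ) →ₗ[ℝ] Matrix (Fin _) (Fin _) ℝ :=
    { toFun := fun y => (momentMatrix y).submatrix e.symm e.symm
      map_add' := fun _ _ => rfl
      map_smul' := fun _ _ => rfl }
  choose α β hαβ using Expo.exists_add (m := m) (d := d)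
  -- Each coordinate of `y` is an entry of its moment matrix.
  let Ψ : Matrix (Fin _) (Fin _) ℝ →ₗ[ℝ] (Expo m (2 * d) → ℝ) :=
    { toFun := fun X γ => X (e (α γ)) (e (β γ))
      map_add' := fun _ _ => rfl
      map_smul' := fun _ _ => rfl }
  have hΨΦ : ∀ y, Ψ (Φ y) = y := fun y => funext fun γ => by
    change momentMatrix y (e.symm (e (α γ))) (e.symm (e (β γ))) = y γ
    simp [momentMatrix, hαβ]
  have hΦ : ∀ y, (Φ y).PosSemidef ↔ (momentMatrix y).PosSemidef := fun y =>
    posSemidef_submatrix_equiv e.symm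
  refine ⟨Fintype.card (Expo m d), LinearMap.range Φ, A.mulVecLin ∘ₗ Ψ, Set.Subset.antisymm ?_ ?_⟩
  · rintro _ ⟨y, -, -, hy, h, rfl⟩
    have heq : (A.mulVecLin ∘ₗ Ψ) (Φ y) = A *ᵥ y := by simp [hΨΦ]
    exact ⟨Φ y, ⟨y, rfl⟩, (hΦ y).2 hy, heq ▸ h, by simp only [heq]⟩
  · rintro _ ⟨_, ⟨y, rfl⟩, hy, h, rfl⟩
    have heq : (A.mulVecLin ∘ₗ Ψ) (Φ y) = A *ᵥ y := by simp [hΨΦ]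
    simp only [heq] at h ⊢
    exact ray_mulVec_mem_momentImage ((hΦ y).1 hy) h

end MomentImage

end MomentHull

theorem corollary1 (m n d : ℕ) (hmd : m = 1 ∨ d = 1 ∨ (d = 2 ∧ m = 2))
    (A : Matrix (Fin (n + 1)) (MomentHull.Expo m (2 * d)) ℝ) :
    MomentHull.conv (MomentHull.variety A) = MomentHull.momentImage A ∧
    (MomentHull.variety A ⊆ MomentHull.nonnegPart 0 →
      MomentHull.conv (MomentHull.variety A) =
        MomentHull.momentImage A ∩ MomentHull.nonnegPart 0) ∧
    MomentHull.IsSemidefiniteRepresentable (MomentHull.conv (MomentHull.variety A)) := by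
  have H : MomentHull.DominatesSquare (m + 1) d := by
    rcases hmd with rfl | rfl | ⟨rfl, rfl⟩
    · exact MomentHull.dominatesSquare_two d
    · exact MomentHull.dominatesSquare_one m
    · exact MomentHull.dominatesSquare_three_two
  have hconv := H.conv_variety_eq A
  refine ⟨hconv, fun hV => ?_, hconv ▸ MomentHull.isSemidefiniteRepresentable_momentImage A⟩
  rw [← hconv]
  exact (Set.inter_eq_left.2 (MomentHull.conv_subset hV (MomentHull.isConvex_nonnegPart 0))).symm
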